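/- Let $D=SL(2,\mathbb C)$, regarded as a real Lie group of dimension $6$, and let $SB(2,\mathbb C)\subset D$ be the subgroup of matrices $$\begin{pmatrix} e^{-z/2} & x+iy\\ 0& e^{z/2}\end{pmatrix},\qquad x,y,z\in\mathbb R .$$ Every $g\in D$ factors uniquely as $g=b_1u_1$ and as $g=u_2b_2$ with $b_1,b_2\in SB(2,\mathbb C)$ and $u_1,u_2\in SU(2)$; put $\pi_1(g)=b_1$ and $\pi_2(g)=b_2$. Let $(e_i)$ be a basis of $\mathfrak{su}(2)$ and $(e^i)$ the basis of $\mathfrak{sb}(2,\mathbb C)$ dual to it with respect to $\langle X,Y\rangle = 2\operatorname{Im}\operatorname{tr}(XY)$, let $r=\sum_i e^i\wedge e_i$, and equip $D$ with the bracket $\{\cdot,\cdot\}_D$ of the bivector field $\tfrac12(r^L+r^R)$, where $r^L$ and $r^R$ are the left- and right-invariant bivector fields with value $r$ at the identity. Equip $SB(2,\mathbb C)$ with the Lie–Poisson bracket $$\{x,y\}=\sinh z,\qquad \{y,z\}=x,\qquad \{z,x\}=y ,$$ and let $c=x^2+y^2+4\sinh^2(z/2)$. Call finitely many smooth functions on a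 manifold generically independent if their differentials are linearly independent at all points of an open dense set. Then: 1. $\{\cdot,\cdot\}_D$ is the Poisson bracket of a symplectic structure on $D$, and $c$ is a Casimir function of $SB(2,\mathbb C)$. 2. The pullback of every smooth function on $SB(2,\mathbb C)$ under $\pi_1$ or $\pi_2$ is smooth; $\pi_1$ is a Poisson map onto $SB(2,\mathbb C)$, and $\pi_2$ is a Poisson map onto $SB(2,\mathbb C)$ with the opposite Poisson structure. 3. $\{f\circ\pi_1,\,g\circ\pi_2\}_D=0$ for all $f,g\in C^\infty(SB(2,\mathbb C))$. 4. For all $f,g\in C^\infty(SB(2,\mathbb C))$ the functions $c\circ\pi_1$, $f\circ\pi_1$, $g\circ\pi_2$ are in involution. They are generically independent on $D$ if and only if $c,f$ are generically independent on $SB(2,\mathbb C)$ and $c,g$ are generically independent on $SB(2,\mathbb C)$. This condition is generic: for every $f\in C^\infty(SB(2,\mathbb C))$ and almost every $(a_0,a_1,a_2)\in\mathbb R^3$, the functions $c$ and $f+a_0x+a_1y+a_2z$ are generically independent. 5. For every $f\in C^\infty(SB(2,\mathbb C))$ the Hamiltonian $H=f\circ\pi_1$ is completely integrable on the symplectic manifold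 $D$: there are three smooth first integrals of $H$ on $D$ that are in involution and generically independent. -/

import Mathlib

open scoped ContDiff Topology

noncomputable section

namespace DoubleSL

/-! ### The groups -/

/-- The double group `D = SL(2,ℂ)`, regarded as a real Lie group of dimension six. -/
abbrev D : Type := Matrix.SpecialLinearGroup (Fin 2) ℂ

/-- The subgroup `SU(2)` of `SL(2,ℂ)`. -/
def SU : Subgroup D where
  carrier := {u | (u : Matrix (Fin 2) (Fin 2) ℂ) ∈ Matrix.unitaryGroup (Fin 2) ℂ}
  one_mem' := by simp
  mul_mem' := by
    intro a b ha hb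
    simpa using mul_mem ha hb
  inv_mem' := by
    intro a ha
    have h1 : (a : Matrix (Fin 2) (Fin 2) ℂ) * (a⁻¹ : D) = 1 := by
      rw [← Matrix.SpecialLinearGroup.coe_mul, mul_inv_cancel, Matrix.SpecialLinearGroup.coe_one]
    have h2 : ((a⁻¹ : D) : Matrix (Fin 2) (Fin 2) ℂ) = star (a : Matrix (Fin 2) (Fin 2) ℂ) := by
      have h3 := Matrix.mem_unitaryGroup_iff'.1 ha
      calc ((a⁻¹ : D) : Matrix (Fin 2) (Fin 2) ℂ)
          = (star (a : Matrix (Fin 2) (Fin 2) ℂ) * (a : Matrix (Fin 2) (Fin 2) ℂ))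
              * ((a⁻¹ : D) : Matrix (Fin 2) (Fin 2) ℂ) := by rw [h3, one_mul]
        _ = _ := by rw [mul_assoc, h1, mul_one]
    show ((a⁻¹ : D) : Matrix (Fin 2) (Fin 2) ℂ) ∈ Matrix.unitaryGroup (Fin 2) ℂ
    rw [h2]
    exact Unitary.star_mem ha

/-- The subgroup `SB(2,ℂ)` of `SL(2,ℂ)`: upper triangular matrices with positive real diagonal. -/
def SB : Subgroup D where
  carrier := {b | b 1 0 = 0 ∧ 0 < (b 0 0).re ∧ (b 0 0).im = 0}
  one_mem' := by simp
  mul_mem' := by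
    rintro a b ⟨ha1, ha2, ha3⟩ ⟨hb1, hb2, hb3⟩
    refine ⟨?_, ?_, ?_⟩
    · simp [Matrix.mul_apply, Fin.sum_univ_two, ha1, hb1]
    · simp [Matrix.mul_apply, Fin.sum_univ_two, hb1, ha3]
      positivity
    · simp [Matrix.mul_apply, Fin.sum_univ_two, hb1, ha3, hb3]
  inv_mem' := by
    rintro a ⟨h1, h2, h3⟩
    have hd := a.det_coe
    rw [Matrix.det_fin_two, h1, mul_zero, sub_zero] at hd
    have h0 : a 0 0 = ((a 0 0).re : ℂ) := Complex.ext (by simp) (by simp [h3])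
    have h11 : a 1 1 = (((a 0 0).re)⁻¹ : ℝ) := by
      have : ((a 0 0).re : ℂ) ≠ 0 := by exact_mod_cast h2.ne'
      rw [h0] at hd
      push_cast
      exact eq_inv_of_mul_eq_one_right hd
    refine ⟨?_, ?_, ?_⟩ <;>
      simp [Matrix.SpecialLinearGroup.coe_inv, Matrix.adjugate_fin_two, h1]
    · rw [h11, Complex.ofReal_re]
      positivity
    · rw [h11, Complex.ofReal_im]

/-- The element of `SB(2,ℂ)` with coordinates `(x, y, z) = (v 0, v 1, v 2)`. -/
def ofCoords (v : Fin 3 → ℝ) : SB :=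
  ⟨⟨!![((Real.exp (-(v 2) / 2) : ℝ) : ℂ), (v 0 : ℂ) + (v 1 : ℂ) * Complex.I;
       0, ((Real.exp (v 2 / 2) : ℝ) : ℂ)], by
      rw [Matrix.det_fin_two_of, mul_zero, sub_zero, ← Complex.ofReal_mul, ← Real.exp_add]
      ring_nf
      simp⟩, by
    refine ⟨by simp, ?_, ?_⟩
    · simp only [Matrix.of_apply, Matrix.cons_val',
        Matrix.cons_val_zero, Matrix.cons_val_fin_one, Complex.ofReal_re]
      positivity
    · simp only [Matrix.of_apply, Matrix.cons_val',
        Matrix.cons_val_zero, Matrix.cons_val_fin_one, Complex.ofReal_im]⟩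

/-- The global coordinates `(x, y, z)` on `SB(2,ℂ)`. -/
def coords (b : SB) : Fin 3 → ℝ :=
  ![((b : D) 0 1).re, ((b : D) 0 1).im, -2 * Real.log ((b : D) 0 0).re]

theorem coords_ofCoords (v : Fin 3 → ℝ) : coords (ofCoords v) = v := by
  funext i
  fin_cases i
  · simp [coords, ofCoords]
  · simp [coords, ofCoords]
  · show -2 * Real.log (((Real.exp (-(v 2) / 2) : ℝ) : ℂ)).re = v 2
    rw [Complex.ofReal_re, Real.log_exp]
    ring

theorem ofCoords_coords (b : SB) : ofCoords (coords b) = b := by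
  obtain ⟨a, h1, h2, h3⟩ := b
  have hd := a.det_coe
  rw [Matrix.det_fin_two, h1, mul_zero, sub_zero] at hd
  have h0 : a 0 0 = ((a 0 0).re : ℂ) := Complex.ext (by simp) (by simp [h3])
  have h11 : a 1 1 = (((a 0 0).re)⁻¹ : ℝ) := by
    have : ((a 0 0).re : ℂ) ≠ 0 := by exact_mod_cast h2.ne'
    rw [h0] at hd
    push_cast
    exact eq_inv_of_mul_eq_one_right hd
  have e1 : -(-2 * Real.log (a 0 0).re) / 2 = Real.log (a 0 0).re := by ring
  have e2 : -2 * Real.log (a 0 0).re / 2 = -Real.log (a 0 0).re := by ring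
  apply Subtype.ext
  apply Matrix.SpecialLinearGroup.ext
  intro i j
  fin_cases i <;> fin_cases j
  · show ((Real.exp (-(-2 * Real.log (a 0 0).re) / 2) : ℝ) : ℂ) = a 0 0
    rw [e1, Real.exp_log h2, ← h0]
  · show (((a 0 1).re : ℝ) : ℂ) + (((a 0 1).im : ℝ) : ℂ) * Complex.I = a 0 1
    exact Complex.re_add_im _
  · exact h1.symm
  · show ((Real.exp (-2 * Real.log (a 0 0).re / 2) : ℝ) : ℂ) = a 1 1
    rw [e2, Real.exp_neg, Real.exp_log h2, ← h11]

/-! ### The two projections `π₁, π₂ : SL(2,ℂ) → SB(2,ℂ)` -/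

/-- `π₁`: the left factor in `SL(2,ℂ) = SB(2,ℂ) · SU(2)`, by orthonormalising the rows.
See `leftProj_eq_iff` for the characterisation. -/
def leftProj (g : D) : SB :=
  let r : ℝ := Real.sqrt (Complex.normSq (g 1 0) + Complex.normSq (g 1 1))
  let n : ℂ := (g 0 0 * star (g 1 0) + g 0 1 * star (g 1 1)) / (r : ℂ)
  ofCoords ![n.re, n.im, 2 * Real.log r]

/-- `π₂`: the right factor in `SL(2,ℂ) = SU(2) · SB(2,ℂ)`, by orthonormalising the columns.
See `rightProj_eq_iff` for the characterisation. -/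
def rightProj (g : D) : SB :=
  let r : ℝ := Real.sqrt (Complex.normSq (g 0 0) + Complex.normSq (g 1 0))
  let n : ℂ := (star (g 0 0) * g 0 1 + star (g 1 0) * g 1 1) / (r : ℂ)
  ofCoords ![n.re, n.im, -2 * Real.log r]


theorem ofCoords_apply (v : Fin 3 → ℝ) :
    ((ofCoords v : D) : Matrix (Fin 2) (Fin 2) ℂ) =
      !![((Real.exp (-(v 2) / 2) : ℝ) : ℂ), (v 0 : ℂ) + (v 1 : ℂ) * Complex.I;
         0, ((Real.exp (v 2 / 2) : ℝ) : ℂ)] := rfl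

theorem SB_inf_SU (b : D) (hb : b ∈ SB) (hu : b ∈ SU) : b = 1 := by
  obtain ⟨h1, h2, h3⟩ := hb
  have hd := b.det_coe
  rw [Matrix.det_fin_two, h1, mul_zero, sub_zero] at hd
  have hU : (star (b : Matrix (Fin 2) (Fin 2) ℂ)) * (b : Matrix (Fin 2) (Fin 2) ℂ) = 1 :=
    Matrix.mem_unitaryGroup_iff'.1 hu
  have e00 := congrFun (congrFun hU 0) 0
  have e01 := congrFun (congrFun hU 0) 1
  simp only [Matrix.mul_apply, Fin.sum_univ_two, Matrix.star_apply, h1, star_zero,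
    add_zero, mul_zero, Matrix.one_apply_eq] at e00
  rw [Matrix.one_apply_ne (by decide)] at e01
  simp only [Matrix.mul_apply, Fin.sum_univ_two, Matrix.star_apply, h1, star_zero, zero_mul,
    add_zero] at e01
  have h00 : b 0 0 = ((b 0 0).re : ℂ) := Complex.ext (by simp) (by simp [h3])
  have hone : b 0 0 = 1 := by
    rw [h00] at e00 ⊢
    rw [Complex.star_def, Complex.conj_ofReal] at e00
    have e : (b 0 0).re * (b 0 0).re = 1 := by exact_mod_cast e00
    have : (b 0 0).re = 1 := by nlinarith
    rw [this]
    simp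
  rw [hone] at hd e01
  rw [star_one, one_mul] at e01
  rw [one_mul] at hd
  apply Matrix.SpecialLinearGroup.ext
  intro i j
  fin_cases i <;> fin_cases j
  · simpa using hone
  · simpa using e01
  · simpa using h1
  · simpa using hd

/-- Every `g` is `π₁(g) · u` with `u ∈ SU(2)`. -/
theorem leftProj_spec (g : D) : ((leftProj g : D))⁻¹ * g ∈ SU := by
  set s : ℝ := Complex.normSq (g 1 0) + Complex.normSq (g 1 1) with hs
  have hd := g.det_coe
  rw [Matrix.det_fin_two] at hd
  have hspos : 0 < s := by
    rcases (add_nonneg (Complex.normSq_nonneg (g 1 0)) (Complex.normSq_nonneg (g 1 1))).lt_or_eq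
      with h | h
    · exact h
    · exfalso
      have h0 : g 1 0 = 0 := Complex.normSq_eq_zero.1 (by
        linarith [Complex.normSq_nonneg (g 1 0), Complex.normSq_nonneg (g 1 1)])
      have h1 : g 1 1 = 0 := Complex.normSq_eq_zero.1 (by
        linarith [Complex.normSq_nonneg (g 1 0), Complex.normSq_nonneg (g 1 1)])
      rw [h0, h1] at hd
      simp at hd
  set r : ℝ := Real.sqrt s with hr
  have hrpos : 0 < r := Real.sqrt_pos.2 hspos
  have hr0 : (r : ℂ) ≠ 0 := by exact_mod_cast hrpos.ne'
  have hrr : (r : ℂ) * r = star (g 1 0) * g 1 0 + star (g 1 1) * g 1 1 := by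
    rw [← Complex.ofReal_mul, Real.mul_self_sqrt hspos.le, hs, Complex.ofReal_add,
      Complex.normSq_eq_conj_mul_self, Complex.normSq_eq_conj_mul_self]
    rfl
  set n : ℂ := (g 0 0 * star (g 1 0) + g 0 1 * star (g 1 1)) / (r : ℂ) with hn
  have hl : ((leftProj g : D) : Matrix (Fin 2) (Fin 2) ℂ) = !![(r : ℂ)⁻¹, n; 0, (r : ℂ)] := by
    have e1 : -(2 * Real.log r) / 2 = - Real.log r := by ring
    have e2 : 2 * Real.log r / 2 = Real.log r := by ring
    show !![((Real.exp (-(2 * Real.log r) / 2) : ℝ) : ℂ),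
        ((n.re : ℝ) : ℂ) + ((n.im : ℝ) : ℂ) * Complex.I;
        0, ((Real.exp (2 * Real.log r / 2) : ℝ) : ℂ)] = _
    rw [e1, e2, Real.exp_neg, Real.exp_log hrpos, Complex.re_add_im, Complex.ofReal_inv]
  have hu : (((leftProj g : D)⁻¹ * g : D) : Matrix (Fin 2) (Fin 2) ℂ) =
      !![star (g 1 1) / r, -star (g 1 0) / r; g 1 0 / r, g 1 1 / r] := by
    rw [Matrix.SpecialLinearGroup.coe_mul, Matrix.SpecialLinearGroup.coe_inv, hl,
      Matrix.adjugate_fin_two_of]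
    ext i j
    fin_cases i <;> fin_cases j <;>
      simp only [Matrix.mul_apply, Fin.sum_univ_two, Fin.zero_eta, Fin.mk_one, Matrix.of_apply,
        Matrix.cons_val', Matrix.cons_val_zero, Matrix.cons_val_one, Matrix.cons_val_fin_one,
        hn] <;> field_simp
    · linear_combination (g 0 0) * hrr + star (g 1 1) * hd
    · linear_combination (g 0 1) * hrr - star (g 1 0) * hd
    · ring
    · ring
  show (((leftProj g : D)⁻¹ * g : D) : Matrix (Fin 2) (Fin 2) ℂ) ∈ Matrix.unitaryGroup (Fin 2) ℂ
  rw [Matrix.mem_unitaryGroup_iff, hu]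
  have hstar : star (r : ℂ) = r := Complex.conj_ofReal r
  ext i j
  fin_cases i <;> fin_cases j <;>
    simp only [Matrix.mul_apply, Fin.sum_univ_two, Fin.zero_eta, Fin.mk_one, Matrix.of_apply,
      Matrix.cons_val', Matrix.cons_val_zero, Matrix.cons_val_one, Matrix.cons_val_fin_one,
      Matrix.star_apply, star_div₀, star_neg, star_star, hstar, Matrix.one_apply_eq, ne_eq,
      zero_ne_one, one_ne_zero, not_false_eq_true, Matrix.one_apply_ne] <;> field_simp
  · linear_combination -hrr
  · ring
  · ring
  · linear_combination -hrr

/-- Every `g` is `u · π₂(g)` with `u ∈ SU(2)`. -/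
theorem rightProj_spec (g : D) : g * ((rightProj g : D))⁻¹ ∈ SU := by
  set s : ℝ := Complex.normSq (g 0 0) + Complex.normSq (g 1 0) with hs
  have hd := g.det_coe
  rw [Matrix.det_fin_two] at hd
  have hspos : 0 < s := by
    rcases (add_nonneg (Complex.normSq_nonneg (g 0 0)) (Complex.normSq_nonneg (g 1 0))).lt_or_eq
      with h | h
    · exact h
    · exfalso
      have h0 : g 0 0 = 0 := Complex.normSq_eq_zero.1 (by
        linarith [Complex.normSq_nonneg (g 0 0), Complex.normSq_nonneg (g 1 0)])
      have h1 : g 1 0 = 0 := Complex.normSq_eq_zero.1 (by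
        linarith [Complex.normSq_nonneg (g 0 0), Complex.normSq_nonneg (g 1 0)])
      rw [h0, h1] at hd
      simp at hd
  set r : ℝ := Real.sqrt s with hr
  have hrpos : 0 < r := Real.sqrt_pos.2 hspos
  have hr0 : (r : ℂ) ≠ 0 := by exact_mod_cast hrpos.ne'
  have hrr : (r : ℂ) * r = star (g 0 0) * g 0 0 + star (g 1 0) * g 1 0 := by
    rw [← Complex.ofReal_mul, Real.mul_self_sqrt hspos.le, hs, Complex.ofReal_add,
      Complex.normSq_eq_conj_mul_self, Complex.normSq_eq_conj_mul_self]
    rfl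
  set n : ℂ := (star (g 0 0) * g 0 1 + star (g 1 0) * g 1 1) / (r : ℂ) with hn
  have hl : ((rightProj g : D) : Matrix (Fin 2) (Fin 2) ℂ) = !![(r : ℂ), n; 0, (r : ℂ)⁻¹] := by
    have e1 : -(-2 * Real.log r) / 2 = Real.log r := by ring
    have e2 : -2 * Real.log r / 2 = - Real.log r := by ring
    show !![((Real.exp (-(-2 * Real.log r) / 2) : ℝ) : ℂ),
        ((n.re : ℝ) : ℂ) + ((n.im : ℝ) : ℂ) * Complex.I;
        0, ((Real.exp (-2 * Real.log r / 2) : ℝ) : ℂ)] = _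
    rw [e1, e2, Real.exp_neg, Real.exp_log hrpos, Complex.re_add_im, Complex.ofReal_inv]
  have hu : ((g * (rightProj g : D)⁻¹ : D) : Matrix (Fin 2) (Fin 2) ℂ) =
      !![g 0 0 / r, -star (g 1 0) / r; g 1 0 / r, star (g 0 0) / r] := by
    rw [Matrix.SpecialLinearGroup.coe_mul, Matrix.SpecialLinearGroup.coe_inv, hl,
      Matrix.adjugate_fin_two_of]
    ext i j
    fin_cases i <;> fin_cases j <;>
      simp only [Matrix.mul_apply, Fin.sum_univ_two, Fin.zero_eta, Fin.mk_one, Matrix.of_apply,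
        Matrix.cons_val', Matrix.cons_val_zero, Matrix.cons_val_one, Matrix.cons_val_fin_one,
        hn] <;> field_simp
    · ring
    · linear_combination (g 0 1) * hrr - star (g 1 0) * hd
    · ring
    · linear_combination (g 1 1) * hrr + star (g 0 0) * hd
  show ((g * (rightProj g : D)⁻¹ : D) : Matrix (Fin 2) (Fin 2) ℂ) ∈ Matrix.unitaryGroup (Fin 2) ℂ
  rw [Matrix.mem_unitaryGroup_iff, hu]
  have hstar : star (r : ℂ) = r := Complex.conj_ofReal r
  ext i j
  fin_cases i <;> fin_cases j <;>
    simp only [Matrix.mul_apply, Fin.sum_univ_two, Fin.zero_eta, Fin.mk_one, Matrix.of_apply,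
      Matrix.cons_val', Matrix.cons_val_zero, Matrix.cons_val_one, Matrix.cons_val_fin_one,
      Matrix.star_apply, star_div₀, star_neg, star_star, hstar, Matrix.one_apply_eq, ne_eq,
      zero_ne_one, one_ne_zero, not_false_eq_true, Matrix.one_apply_ne] <;> field_simp
  · linear_combination -hrr
  · ring
  · ring
  · linear_combination -hrr

/-- `π₁(g)` is the unique `b ∈ SB(2,ℂ)` with `g ∈ b · SU(2)`. -/
theorem leftProj_eq_iff (g : D) (b : SB) : leftProj g = b ↔ (b : D)⁻¹ * g ∈ SU := by
  refine ⟨fun h => h ▸ leftProj_spec g, fun h => ?_⟩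
  have h1 : (leftProj g : D)⁻¹ * (b : D) ∈ SU := by
    have := SU.mul_mem (leftProj_spec g) (SU.inv_mem h)
    convert this using 1
    group
  have h2 := SB_inf_SU _ (SB.mul_mem (SB.inv_mem (leftProj g).2) b.2) h1
  exact Subtype.ext (inv_mul_eq_one.1 h2)

/-- `π₂(g)` is the unique `b ∈ SB(2,ℂ)` with `g ∈ SU(2) · b`. -/
theorem rightProj_eq_iff (g : D) (b : SB) : rightProj g = b ↔ g * (b : D)⁻¹ ∈ SU := by
  refine ⟨fun h => h ▸ rightProj_spec g, fun h => ?_⟩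
  have h1 : (b : D) * (rightProj g : D)⁻¹ ∈ SU := by
    have := SU.mul_mem (SU.inv_mem h) (rightProj_spec g)
    convert this using 1
    group
  have h2 := SB_inf_SU _ (SB.mul_mem b.2 (SB.inv_mem (rightProj g).2)) h1
  exact Subtype.ext (mul_inv_eq_one.1 h2).symm

/-! ### Smooth functions, invariant vector fields and differentials on `SL(2,ℂ)` -/

/-- `φ ∈ C^∞(SL(2,ℂ))`, for the closed submanifold `SL(2,ℂ)` of the real vector space of complex
`2 × 2` matrices: near each point, `φ` is the restriction of a smooth function of the matrix
entries. -/
def SmoothD (φ : D → ℝ) : Prop :=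
  ∀ g : D, ∃ F : (Fin 2 → Fin 2 → ℂ) → ℝ,
    ContDiffAt ℝ ∞ F (fun i j => g i j) ∧ ∀ᶠ h : D in 𝓝 g, φ h = F (fun i j => h i j)

/-- The Lie algebra `sl(2,ℂ)` of traceless matrices. -/
abbrev sl2 : Type := LieAlgebra.SpecialLinear.sl (Fin 2) ℂ

theorem trace_sl2 (X : sl2) : Matrix.trace (X : Matrix (Fin 2) (Fin 2) ℂ) = 0 :=
  LinearMap.mem_ker.1 X.2

theorem det_exp_sl2 (X : sl2) :
    Matrix.det (NormedSpace.exp (X : Matrix (Fin 2) (Fin 2) ℂ)) = 1 := by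
  obtain ⟨X, hX⟩ := X
  have hX : Matrix.trace X = 0 := LinearMap.mem_ker.1 hX
  show Matrix.det (NormedSpace.exp X) = 1
  let J : Matrix (Fin 2) (Fin 2) ℂ := !![0, 1; -1, 0]
  let J' : Matrix (Fin 2) (Fin 2) ℂ := !![0, -1; 1, 0]
  have hJJ : J * J' = 1 := by
    ext i j
    fin_cases i <;> fin_cases j <;> simp [J, J', Matrix.mul_apply, Fin.sum_univ_two]
  have hJ'J : J' * J = 1 := by
    ext i j
    fin_cases i <;> fin_cases j <;> simp [J, J', Matrix.mul_apply, Fin.sum_univ_two]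
  let U : (Matrix (Fin 2) (Fin 2) ℂ)ˣ := ⟨J, J', hJJ, hJ'J⟩
  have hadj : ∀ M : Matrix (Fin 2) (Fin 2) ℂ, M.adjugate = J * M.transpose * J' := by
    intro M
    rw [Matrix.adjugate_fin_two]
    ext i j
    fin_cases i <;> fin_cases j <;>
      simp [J, J', Matrix.mul_apply, Fin.sum_univ_two, Matrix.vecMul, dotProduct,
        Matrix.transpose_apply]
  have hneg : X.adjugate = -X := by
    rw [Matrix.trace_fin_two] at hX
    rw [Matrix.adjugate_fin_two]
    ext i j
    fin_cases i <;> fin_cases j <;> simp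
    · linear_combination hX
    · linear_combination hX
  have hexp : (NormedSpace.exp X).adjugate = NormedSpace.exp (-X) := by
    rw [hadj, ← Matrix.exp_transpose]
    have := Matrix.exp_units_conj U X.transpose
    rw [show ((U : (Matrix (Fin 2) (Fin 2) ℂ)ˣ) : Matrix (Fin 2) (Fin 2) ℂ) = J from rfl,
      show ((U⁻¹ : (Matrix (Fin 2) (Fin 2) ℂ)ˣ) : Matrix (Fin 2) (Fin 2) ℂ) = J' from rfl,
      ← hadj, hneg] at this
    exact this.symm
  have h1 := Matrix.mul_adjugate (NormedSpace.exp X)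
  rw [hexp, ← Matrix.exp_add_of_commute _ _ (Commute.neg_right (Commute.refl X)), add_neg_cancel,
    NormedSpace.exp_zero] at h1
  have h2 := congrFun (congrFun h1 0) 0
  simpa using h2.symm

/-- The exponential map `sl(2,ℂ) → SL(2,ℂ)`. -/
def expD (X : sl2) : D := ⟨NormedSpace.exp (X : Matrix (Fin 2) (Fin 2) ℂ), det_exp_sl2 X⟩

/-- The derivative at `g` of `φ` along the left-invariant vector field generated by `X`.
As `X` runs through `sl(2,ℂ)`, this is the differential of `φ` at `g`, in the left
trivialisation `X ↦ gX` of the tangent space. -/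
def leftDer (φ : D → ℝ) (g : D) (X : sl2) : ℝ :=
  deriv (fun t : ℝ => φ (g * expD ((t : ℂ) • X))) 0

/-- The derivative at `g` of `φ` along the right-invariant vector field generated by `X`. -/
def rightDer (φ : D → ℝ) (g : D) (X : sl2) : ℝ :=
  deriv (fun t : ℝ => φ (expD ((t : ℂ) • X) * g)) 0

/-- A traceless matrix as an element of `sl(2,ℂ)`. -/
def mkSl2 (a b c : ℂ) : sl2 :=
  ⟨!![a, b; c, -a], LinearMap.mem_ker.2 (by
    rw [Matrix.traceLinearMap_apply, Matrix.trace_fin_two_of, add_neg_cancel])⟩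

/-- The invariant scalar product of the Manin triple `(sl(2,ℂ), su(2), sb(2,ℂ))`. -/
def pairing (X Y : sl2) : ℝ :=
  2 * (Matrix.trace ((X : Matrix (Fin 2) (Fin 2) ℂ) * (Y : Matrix (Fin 2) (Fin 2) ℂ))).im

/-- A basis of `su(2)`. -/
def suBasis : Fin 3 → sl2 :=
  ![mkSl2 0 Complex.I Complex.I, mkSl2 0 1 (-1), mkSl2 Complex.I 0 0]

/-- The basis of `sb(2,ℂ)` dual to `suBasis` with respect to `pairing`. -/
def sbBasis : Fin 3 → sl2 :=
  ![mkSl2 0 (1 / 2) 0, mkSl2 0 (-Complex.I / 2) 0, mkSl2 (1 / 4) 0 0]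

theorem pairing_suBasis_sbBasis (i j : Fin 3) :
    pairing (suBasis i) (sbBasis j) = if i = j then 1 else 0 := by
  fin_cases i <;> fin_cases j <;>
    simp [pairing, suBasis, sbBasis, mkSl2, Matrix.trace_fin_two] <;> norm_num

theorem pairing_suBasis_suBasis (i j : Fin 3) : pairing (suBasis i) (suBasis j) = 0 := by
  fin_cases i <;> fin_cases j <;>
    simp [pairing, suBasis, mkSl2, Matrix.trace_fin_two]

theorem pairing_sbBasis_sbBasis (i j : Fin 3) : pairing (sbBasis i) (sbBasis j) = 0 := by
  fin_cases i <;> fin_cases j <;>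
    simp [pairing, sbBasis, mkSl2, Matrix.trace_fin_two]

/-- The Poisson bracket of the symplectic structure of the Drinfeld double `SL(2,ℂ)`: the bivector
field is `½ (r^L + r^R)`, where `r = ∑ᵢ eⁱ ∧ eᵢ` for dual bases `(eᵢ)` of `su(2)` and `(eⁱ)` of
`sb(2,ℂ)`, and `r^L`, `r^R` are the left- and right-invariant bivector fields with value `r`
at the identity. -/
def bracketD (φ ψ : D → ℝ) (g : D) : ℝ :=
  (1 / 2) * ∑ i : Fin 3,
    ((leftDer φ g (sbBasis i) * leftDer ψ g (suBasis i)
        - leftDer φ g (suBasis i) * leftDer ψ g (sbBasis i))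
      + (rightDer φ g (sbBasis i) * rightDer ψ g (suBasis i)
        - rightDer φ g (suBasis i) * rightDer ψ g (sbBasis i)))

/-- `P` is the Poisson bracket of a symplectic structure on `SL(2,ℂ)`: a skew-symmetric
real-bilinear biderivation of `C^∞(SL(2,ℂ))` with the Jacobi identity, nondegenerate at every
point. -/
structure IsSymplecticBracket (P : (D → ℝ) → (D → ℝ) → D → ℝ) : Prop where
  smooth : ∀ φ ψ, SmoothD φ → SmoothD ψ → SmoothD (P φ ψ)
  skew : ∀ φ ψ, SmoothD φ → SmoothD ψ → ∀ g, P φ ψ g = -P ψ φ g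
  linear : ∀ (a : ℝ) (φ χ ψ), SmoothD φ → SmoothD χ → SmoothD ψ →
    ∀ g, P (fun h => a * φ h + χ h) ψ g = a * P φ ψ g + P χ ψ g
  leibniz : ∀ φ χ ψ, SmoothD φ → SmoothD χ → SmoothD ψ →
    ∀ g, P (fun h => φ h * χ h) ψ g = φ g * P χ ψ g + P φ ψ g * χ g
  jacobi : ∀ φ χ ψ, SmoothD φ → SmoothD χ → SmoothD ψ →
    ∀ g, P φ (P χ ψ) g + P χ (P ψ φ) g + P ψ (P φ χ) g = 0
  nondegenerate : ∀ φ, SmoothD φ → ∀ g, (∀ ψ, SmoothD ψ → P φ ψ g = 0) →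
    ∀ X : sl2, leftDer φ g X = 0

/-- Functions on `SL(2,ℂ)` are generically independent: their differentials are linearly
independent at every point of an open dense set. -/
def GenIndepD {k : ℕ} (F : Fin k → D → ℝ) : Prop :=
  ∃ U : Set D, IsOpen U ∧ Dense U ∧ ∀ g ∈ U, LinearIndependent ℝ (fun i => leftDer (F i) g)

/-- Liouville–Arnold integrability of the Hamiltonian system `H` on the six-dimensional symplectic
manifold `SL(2,ℂ)`: there are three smooth first integrals of `H` which are in involution and
functionally independent on an open dense set. -/
def CompletelyIntegrable (H : D → ℝ) : Prop :=
  SmoothD H ∧ ∃ F : Fin 3 → D → ℝ,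
    (∀ i, SmoothD (F i)) ∧
    (∀ i g, bracketD (F i) H g = 0) ∧
    (∀ i j g, bracketD (F i) (F j) g = 0) ∧
    GenIndepD F

/-! ### The Lie–Poisson group `SB(2,ℂ)` -/

/-- `f ∈ C^∞(SB(2,ℂ))`, in the global coordinates. -/
def SmoothSB (f : SB → ℝ) : Prop := ContDiff ℝ ∞ (fun v => f (ofCoords v))

/-- The differential of `f` at `b`, in the global coordinates. -/
def diffSB (f : SB → ℝ) (b : SB) : (Fin 3 → ℝ) →L[ℝ] ℝ :=
  fderiv ℝ (fun v => f (ofCoords v)) (coords b)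

/-- The partial derivative of `f` with respect to the `i`-th coordinate. -/
def partialSB (i : Fin 3) (f : SB → ℝ) (b : SB) : ℝ := diffSB f b (Pi.single i 1)

/-- The Lie–Poisson bracket on `SB(2,ℂ)` for which the dual group is `SU(2)`:
`{x, y} = sinh z`, `{y, z} = x`, `{z, x} = y`. -/
def bracketSB (f h : SB → ℝ) (b : SB) : ℝ :=
  Real.sinh (coords b 2) * (partialSB 0 f b * partialSB 1 h b - partialSB 1 f b * partialSB 0 h b)
    + coords b 0 * (partialSB 1 f b * partialSB 2 h b - partialSB 2 f b * partialSB 1 h b)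
    + coords b 1 * (partialSB 2 f b * partialSB 0 h b - partialSB 0 f b * partialSB 2 h b)

/-- The Casimir function `c = x² + y² + 4 sinh²(z/2)`. -/
def casimir (b : SB) : ℝ :=
  coords b 0 ^ 2 + coords b 1 ^ 2 + 4 * Real.sinh (coords b 2 / 2) ^ 2

/-- Functions on `SB(2,ℂ)` are generically independent: their differentials are linearly
independent at every point of an open dense set. -/
def GenIndepSB {k : ℕ} (F : Fin k → SB → ℝ) : Prop :=
  ∃ U : Set SB, IsOpen U ∧ Dense U ∧ ∀ b ∈ U, LinearIndependent ℝ (fun i => diffSB (F i) b)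

end DoubleSL

end

noncomputable section

namespace DoubleSL

/-! ### Calculus on `SL(2,ℂ)` in the ambient space of matrices -/

/-! All calculus on `D` takes place in the real vector space `Amb` of matrices. A smooth function
extends locally to `Amb`, and its derivatives along the left- and right-invariant fields of X are
the derivatives of the extension in the directions gX and Xg. The bivector field is thus built from
linear vector fields.

Symplectic structure. Write a covector as Y ↦ 2 Im tr(AY). Contraction with r becomes `rho`, the
su(2)-projection minus the sb(2,ℂ)-projection of the traceless part, and the Hamiltonian vector at m
is ½(m·rho(Am) + rho(mA)·m). In the Jacobi identity the second derivatives cancel; what remains is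
the difference of two modified Yang–Baxter identities, for the elements Am and for the elements mA,
whose right-hand sides agree by cyclicity of the trace. If a Hamiltonian vector vanishes at g, then
g exchanges su(2)-parts with sb(2,ℂ)-parts; the real part of the determinant is nonnegative on the
former and nonpositive on the latter, which forces the parts to vanish.

Projections. π₁ is invariant under right multiplication by SU(2), so r^L contributes nothing to
brackets of functions f ∘ π₁, and r^R is computed in the coordinates of π₁. Exchanging the diagonal
entries is an anti-automorphism which swaps π₁ and π₂, preserves the bracket of `D` and reverses
that of `SB`; this transfers everything to π₂. For one function of each kind, r^L and r^R give the
same invariant pairing of the differentials with opposite signs (`bracketD_leftProj_rightProj`).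

Independence. Both c ∘ π₁ and c ∘ π₂ equal the squared Frobenius norm minus 2. A covector pulled
back along both projections is annihilated by the bracket with every function of π₁, so downstairs
it has zero Hamiltonian vector. Hence the independence of the three functions at g amounts to `hamSB
f` ≠ 0 at π₁(g) and `hamSB h` ≠ 0 at π₂(g) (`linearIndependent_pullback_iff`). As both projections
are continuous open surjections, density passes up and down.

Genericity and integrability. At a fixed point other than the identity, the Hamiltonian vector of f
+ a·(x, y, z) is a nonconstant affine function of a, so it vanishes only on a null set of a; a
countable basis of open sets gives density. If f depends on c on an open set W, it is perturbed
inside W alone by a cutoff linear function. The result still commutes with f, and serves as the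
missing integral. -/

/-- The real normed space of complex `2 × 2` matrices. -/
abbrev Amb : Type := Fin 2 → Fin 2 → ℂ

/-- The inclusion of `SL(2,ℂ)` in the space of matrices. -/
abbrev amb (g : D) : Amb := fun i j => g i j

/-- Multiplication by `X` on the right, as a real linear map. -/
def mulR (X : Matrix (Fin 2) (Fin 2) ℂ) : Amb →L[ℝ] Amb :=
  LinearMap.toContinuousLinearMap
    { toFun := fun m i j => ∑ k, m i k * X k j
      map_add' := by
        intro m n
        funext i j
        simp [add_mul, Finset.sum_add_distrib]
      map_smul' := by
        intro c m
        funext i j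
        simp [mul_assoc] }

/-- Multiplication by `X` on the left, as a real linear map. -/
def mulL (X : Matrix (Fin 2) (Fin 2) ℂ) : Amb →L[ℝ] Amb :=
  LinearMap.toContinuousLinearMap
    { toFun := fun m i j => ∑ k, X i k * m k j
      map_add' := by
        intro m n
        funext i j
        simp [mul_add, Finset.sum_add_distrib]
      map_smul' := by
        intro c m
        funext i j
        simp only [Fin.sum_univ_two, Pi.smul_apply, Complex.real_smul, RingHom.id_apply]
        ring }

theorem mulR_apply (X : Matrix (Fin 2) (Fin 2) ℂ) (m : Amb) :
    mulR X m = (Matrix.of m * X : Matrix (Fin 2) (Fin 2) ℂ) := rfl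

theorem mulL_apply (X : Matrix (Fin 2) (Fin 2) ℂ) (m : Amb) :
    mulL X m = (X * Matrix.of m : Matrix (Fin 2) (Fin 2) ℂ) := rfl

theorem continuous_amb : Continuous amb := by
  have h : Continuous fun g : D => (g : Matrix (Fin 2) (Fin 2) ℂ) := continuous_subtype_val
  exact continuous_pi fun i => continuous_pi fun j => h.matrix_elem i j

open scoped Matrix.Norms.Operator in
theorem hasDerivAt_exp_entry (X : Matrix (Fin 2) (Fin 2) ℂ) (i j : Fin 2) :
    HasDerivAt (fun t : ℝ => NormedSpace.exp ((t : ℂ) • X) i j) (X i j) 0 := by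
  have h := hasDerivAt_exp_smul_const (𝕂 := ℝ) X 0
  have h2 := (LinearMap.toContinuousLinearMap
    (Matrix.entryLinearMap ℝ ℂ i j)).hasFDerivAt.comp_hasDerivAt 0 h
  simp only [zero_smul, NormedSpace.exp_zero, one_mul] at h2
  exact h2

theorem hasDerivAt_mul_expD (g : D) (X : sl2) :
    HasDerivAt (fun t : ℝ => amb (g * expD ((t : ℂ) • X))) (mulR X (amb g)) 0 := by
  refine hasDerivAt_pi.2 fun i => hasDerivAt_pi.2 fun j => ?_
  have h := HasDerivAt.fun_sum (u := Finset.univ) fun (k : Fin 2) _ =>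
    (hasDerivAt_exp_entry X k j).const_mul (g i k)
  exact h

theorem hasDerivAt_expD_mul (g : D) (X : sl2) :
    HasDerivAt (fun t : ℝ => amb (expD ((t : ℂ) • X) * g)) (mulL X (amb g)) 0 := by
  refine hasDerivAt_pi.2 fun i => hasDerivAt_pi.2 fun j => ?_
  have h := HasDerivAt.fun_sum (u := Finset.univ) fun (k : Fin 2) _ =>
    (hasDerivAt_exp_entry X i k).mul_const (g k j)
  exact h

theorem expD_zero_smul (X : sl2) : expD (((0 : ℝ) : ℂ) • X) = 1 := by
  apply Subtype.ext
  simp [expD]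

theorem continuousAt_D {f : ℝ → D} (h : ContinuousAt (fun t => amb (f t)) 0) :
    ContinuousAt f 0 := by
  have : Topology.IsInducing (fun g : D => (g : Matrix (Fin 2) (Fin 2) ℂ)) := ⟨rfl⟩
  exact this.continuousAt_iff.2 h

theorem tendsto_mul_expD (g : D) (X : sl2) :
    Filter.Tendsto (fun t : ℝ => g * expD ((t : ℂ) • X)) (𝓝 0) (𝓝 g) := by
  have h := (continuousAt_D (hasDerivAt_mul_expD g X).continuousAt).tendsto
  rwa [expD_zero_smul, mul_one] at h

theorem tendsto_expD_mul (g : D) (X : sl2) :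
    Filter.Tendsto (fun t : ℝ => expD ((t : ℂ) • X) * g) (𝓝 0) (𝓝 g) := by
  have h := (continuousAt_D (hasDerivAt_expD_mul g X).continuousAt).tendsto
  rwa [expD_zero_smul, one_mul] at h

/-- Chain rule along t ↦ g·exp(tX), whose velocity at 0 is gX. Agreement of `φ` and `F` near g is
enough because the curve tends to g. -/
theorem leftDer_eq {φ : D → ℝ} {g : D} {F : Amb → ℝ} (hF : DifferentiableAt ℝ F (amb g))
    (h : ∀ᶠ p in 𝓝 g, φ p = F (amb p)) (X : sl2) :
    leftDer φ g X = fderiv ℝ F (amb g) (mulR X (amb g)) := by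
  have h0 : amb (g * expD (((0 : ℝ) : ℂ) • X)) = amb g := by rw [expD_zero_smul, mul_one]
  have h1 := (h0 ▸ hF.hasFDerivAt : HasFDerivAt F (fderiv ℝ F (amb g))
    (amb (g * expD (((0 : ℝ) : ℂ) • X)))).comp_hasDerivAt 0 (hasDerivAt_mul_expD g X)
  exact (h1.congr_of_eventuallyEq ((tendsto_mul_expD g X).eventually h)).deriv

theorem rightDer_eq {φ : D → ℝ} {g : D} {F : Amb → ℝ} (hF : DifferentiableAt ℝ F (amb g))
    (h : ∀ᶠ p in 𝓝 g, φ p = F (amb p)) (X : sl2) :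
    rightDer φ g X = fderiv ℝ F (amb g) (mulL X (amb g)) := by
  have h0 : amb (expD (((0 : ℝ) : ℂ) • X) * g) = amb g := by rw [expD_zero_smul, one_mul]
  have h1 := (h0 ▸ hF.hasFDerivAt : HasFDerivAt F (fderiv ℝ F (amb g))
    (amb (expD (((0 : ℝ) : ℂ) • X) * g))).comp_hasDerivAt 0 (hasDerivAt_expD_mul g X)
  exact (h1.congr_of_eventuallyEq ((tendsto_expD_mul g X).eventually h)).deriv

/-! ### Bivector fields with linear coefficients -/

section LinearBivector

variable {ι E : Type*} [Fintype ι] [NormedAddCommGroup E] [NormedSpace ℝ E]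

/-- The bivector `∑ₐ vₐ(m) ∧ wₐ(m)`, for linear vector fields `vₐ`, `wₐ`. -/
def linBivec (v w : ι → E →L[ℝ] E) (m : E) (α β : E →L[ℝ] ℝ) : ℝ :=
  ∑ a, (α (v a m) * β (w a m) - α (w a m) * β (v a m))

/-- The value at `u` of the vector field with linear coefficients obtained by contracting
`linBivec` at `m` with a covector. -/
def linHam (v w : ι → E →L[ℝ] E) (m u : E) (α : E →L[ℝ] ℝ) : E :=
  ∑ a, (α (v a m) • w a u - α (w a m) • v a u)

/-- The derivative of `linBivec` in the direction `u`. -/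
def linBivecDeriv (v w : ι → E →L[ℝ] E) (m u : E) (α β : E →L[ℝ] ℝ) : ℝ :=
  β (linHam v w m u α) - α (linHam v w m u β)

theorem apply_linHam (v w : ι → E →L[ℝ] E) (m : E) (α β : E →L[ℝ] ℝ) :
    β (linHam v w m m α) = linBivec v w m α β := by
  simp [linHam, linBivec]

theorem linBivec_skew (v w : ι → E →L[ℝ] E) (m : E) (α β : E →L[ℝ] ℝ) :
    linBivec v w m α β = -linBivec v w m β α := by
  rw [linBivec, linBivec, ← Finset.sum_neg_distrib]
  exact Finset.sum_congr rfl fun a _ => by ring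

theorem contDiffAt_linBivec (v w : ι → E →L[ℝ] E) {F G : E → ℝ} {m : E}
    (hF : ContDiffAt ℝ ∞ F m) (hG : ContDiffAt ℝ ∞ G m) :
    ContDiffAt ℝ ∞ (fun p => linBivec v w p (fderiv ℝ F p) (fderiv ℝ G p)) m := by
  have hF' : ContDiffAt ℝ ∞ (fderiv ℝ F) m := hF.fderiv_right le_rfl
  have hG' : ContDiffAt ℝ ∞ (fderiv ℝ G) m := hG.fderiv_right le_rfl
  have hv : ∀ a, ContDiffAt ℝ ∞ (fun p => v a p) m := fun a => (v a).contDiff.contDiffAt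
  have hw : ∀ a, ContDiffAt ℝ ∞ (fun p => w a p) m := fun a => (w a).contDiff.contDiffAt
  refine ContDiffAt.sum fun a _ => ?_
  exact ((hF'.clm_apply (hv a)).mul (hG'.clm_apply (hw a))).sub
    ((hF'.clm_apply (hw a)).mul (hG'.clm_apply (hv a)))

theorem fderiv_linBivec (v w : ι → E →L[ℝ] E) {F G : E → ℝ} {m : E}
    (hF : ContDiffAt ℝ ∞ F m) (hG : ContDiffAt ℝ ∞ G m) (u : E) :
    fderiv ℝ (fun p => linBivec v w p (fderiv ℝ F p) (fderiv ℝ G p)) m u =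
      linBivecDeriv v w m u (fderiv ℝ F m) (fderiv ℝ G m)
        + linBivec v w m (fderiv ℝ (fderiv ℝ F) m u) (fderiv ℝ G m)
        + linBivec v w m (fderiv ℝ F m) (fderiv ℝ (fderiv ℝ G) m u) := by
  have hF' : ContDiffAt ℝ ∞ (fderiv ℝ F) m := hF.fderiv_right le_rfl
  have hG' : ContDiffAt ℝ ∞ (fderiv ℝ G) m := hG.fderiv_right le_rfl
  have dF := (hF'.differentiableAt (by simp)).hasFDerivAt
  have dG := (hG'.differentiableAt (by simp)).hasFDerivAt
  have key := HasFDerivAt.fun_sum (u := Finset.univ) fun (a : ι) _ =>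
    ((dF.clm_apply (v a).hasFDerivAt).mul (dG.clm_apply (w a).hasFDerivAt)).sub
      ((dF.clm_apply (w a).hasFDerivAt).mul (dG.clm_apply (v a).hasFDerivAt))
  have := key.fderiv
  change fderiv ℝ (fun p => linBivec v w p (fderiv ℝ F p) (fderiv ℝ G p)) m = _ at this
  rw [this, linBivecDeriv, linHam, linHam, linBivec, linBivec, map_sum, map_sum,
    ← Finset.sum_sub_distrib, ← Finset.sum_add_distrib, ← Finset.sum_add_distrib, sum_apply]
  refine Finset.sum_congr rfl fun a _ => ?_
  simp
  ring

/-- The Jacobi identity for a bivector field with linear coefficients, reduced to an algebraic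
identity between covectors. -/
theorem linBivec_jacobi (v w : ι → E →L[ℝ] E) (m : E)
    (halg : ∀ α β γ : E →L[ℝ] ℝ,
      linBivecDeriv v w m (linHam v w m m α) β γ + linBivecDeriv v w m (linHam v w m m β) γ α
        + linBivecDeriv v w m (linHam v w m m γ) α β = 0)
    {F G H : E → ℝ} (hF : ContDiffAt ℝ ∞ F m) (hG : ContDiffAt ℝ ∞ G m)
    (hH : ContDiffAt ℝ ∞ H m) :
    linBivec v w m (fderiv ℝ F m)
        (fderiv ℝ (fun p => linBivec v w p (fderiv ℝ G p) (fderiv ℝ H p)) m)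
      + linBivec v w m (fderiv ℝ G m)
        (fderiv ℝ (fun p => linBivec v w p (fderiv ℝ H p) (fderiv ℝ F p)) m)
      + linBivec v w m (fderiv ℝ H m)
        (fderiv ℝ (fun p => linBivec v w p (fderiv ℝ F p) (fderiv ℝ G p)) m) = 0 := by
  have key : ∀ {F G H : E → ℝ}, ContDiffAt ℝ ∞ G m → ContDiffAt ℝ ∞ H m →
      linBivec v w m (fderiv ℝ F m)
        (fderiv ℝ (fun p => linBivec v w p (fderiv ℝ G p) (fderiv ℝ H p)) m) =
      linBivecDeriv v w m (linHam v w m m (fderiv ℝ F m)) (fderiv ℝ G m) (fderiv ℝ H m)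
        - fderiv ℝ (fderiv ℝ G) m (linHam v w m m (fderiv ℝ F m)) (linHam v w m m (fderiv ℝ H m))
        + fderiv ℝ (fderiv ℝ H) m (linHam v w m m (fderiv ℝ F m))
            (linHam v w m m (fderiv ℝ G m)) := by
    intro F G H hG hH
    rw [← apply_linHam, fderiv_linBivec v w hG hH, linBivec_skew v w m _ (fderiv ℝ H m),
      ← apply_linHam, ← apply_linHam]
    ring
  have sym : ∀ {F : E → ℝ}, ContDiffAt ℝ ∞ F m → IsSymmSndFDerivAt ℝ F m := fun hF =>
    
    hF.isSymmSndFDerivAt (by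
      rw [minSmoothness_of_isRCLikeNormedField]
      exact WithTop.coe_le_coe.2 (le_top : (2 : ℕ∞) ≤ ⊤))
  -- Each function contributes its Hessian twice, with opposite signs, on the Hamiltonian vectors of
  -- the other two; symmetry makes these terms cancel and leaves `halg`.
  rw [key hG hH, key hH hF, key hF hG, (sym hF).eq (linHam v w m m (fderiv ℝ G m)),
    (sym hG).eq (linHam v w m m (fderiv ℝ H m)), (sym hH).eq (linHam v w m m (fderiv ℝ F m))]
  linear_combination halg (fderiv ℝ F m) (fderiv ℝ G m) (fderiv ℝ H m)

end LinearBivector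

/-! ### The bivector field of the double in the ambient space -/

theorem exists_trace_repr (α : Amb →L[ℝ] ℝ) : ∃ A : Matrix (Fin 2) (Fin 2) ℂ,
    ∀ Y : Matrix (Fin 2) (Fin 2) ℂ, α Y = 2 * (Matrix.trace (A * Y)).im := by
  let e (i j : Fin 2) (c : ℂ) : Amb := fun k l => if k = i ∧ l = j then c else 0
  -- Since Im((p + iq)(u + iv)) = pv + qu, the real part of an entry of A is read off from the
  -- imaginary direction and the imaginary part from the real one. The trace transposes the indices.
  refine ⟨Matrix.of fun j i => ⟨α (e i j Complex.I) / 2, α (e i j 1) / 2⟩, fun Y => ?_⟩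
  have hY : (Y : Amb) = ∑ i : Fin 2, ∑ j : Fin 2,
      ((Y i j).re • e i j 1 + (Y i j).im • e i j Complex.I) := by
    funext k l
    fin_cases k <;> fin_cases l <;> simp [e, Fin.sum_univ_two]
  have h := congrArg α hY
  rw [map_sum] at h
  simp only [map_add, map_smul, smul_eq_mul, Fin.sum_univ_two] at h
  refine h.trans ?_
  simp only [Matrix.trace_fin_two, Matrix.mul_apply, Fin.sum_univ_two, Complex.add_im,
    Complex.mul_im, Matrix.of_apply]
  ring

/-- The `sb(2,ℂ)` halves of the linear vector fields spanning the bivector field of the double. -/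
def dblV : Fin 3 ⊕ Fin 3 → Amb →L[ℝ] Amb :=
  Sum.elim (fun i => (1 / 2 : ℝ) • mulR (sbBasis i)) fun i => (1 / 2 : ℝ) • mulL (sbBasis i)

/-- The `su(2)` halves of the linear vector fields spanning the bivector field of the double. -/
def dblW : Fin 3 ⊕ Fin 3 → Amb →L[ℝ] Amb :=
  Sum.elim (fun i => mulR (suBasis i)) fun i => mulL (suBasis i)

theorem bracketD_eq {φ ψ : D → ℝ} {g : D} {F G : Amb → ℝ}
    (hF : DifferentiableAt ℝ F (amb g)) (hφ : ∀ᶠ p in 𝓝 g, φ p = F (amb p))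
    (hG : DifferentiableAt ℝ G (amb g)) (hψ : ∀ᶠ p in 𝓝 g, ψ p = G (amb p)) :
    bracketD φ ψ g = linBivec dblV dblW (amb g) (fderiv ℝ F (amb g)) (fderiv ℝ G (amb g)) := by
  simp only [bracketD, leftDer_eq hF hφ, leftDer_eq hG hψ, rightDer_eq hF hφ,
    rightDer_eq hG hψ, linBivec, dblV, dblW, Fintype.sum_sum_type, Sum.elim_inl, Sum.elim_inr,
    smul_apply, map_smul, smul_eq_mul, Fin.sum_univ_three]
  ring

/-- The difference of the projections of the traceless part to `su(2)` and to `sb(2,ℂ)`. -/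
def rho (Z : Matrix (Fin 2) (Fin 2) ℂ) : Matrix (Fin 2) (Fin 2) ℂ :=
  !![-star (Z 0 0 - Z 1 1) / 2, -Z 0 1 - 2 * star (Z 1 0); Z 1 0, star (Z 0 0 - Z 1 1) / 2]

theorem rho_eq_sum (Z : Matrix (Fin 2) (Fin 2) ℂ) :
    rho Z = ∑ i : Fin 3,
      ((2 * (Matrix.trace (Z * (sbBasis i : Matrix (Fin 2) (Fin 2) ℂ))).im : ℝ) •
          (suBasis i : Matrix (Fin 2) (Fin 2) ℂ)
        - (2 * (Matrix.trace (Z * (suBasis i : Matrix (Fin 2) (Fin 2) ℂ))).im : ℝ) •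
          (sbBasis i : Matrix (Fin 2) (Fin 2) ℂ)) := by
  ext i j
  fin_cases i <;> fin_cases j <;> apply Complex.ext <;>
    simp [rho, Fin.sum_univ_three, sbBasis, suBasis, mkSl2, Matrix.trace_fin_two,
      Matrix.mul_apply, Fin.sum_univ_two] <;> ring

/-- By cyclicity α(mX) and α(Xm) are the pairings of X with Am and mA, so the two halves of the sum
are the expansion `rho_eq_sum` of `rho`. The point u is kept apart from m because differentiating
the bivector field moves only one of the two linear factors. -/
theorem linHam_dbl (m u : Matrix (Fin 2) (Fin 2) ℂ) {α : Amb →L[ℝ] ℝ}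
    {A : Matrix (Fin 2) (Fin 2) ℂ}
    (hα : ∀ Y : Matrix (Fin 2) (Fin 2) ℂ, α Y = 2 * (Matrix.trace (A * Y)).im) :
    linHam dblV dblW m u α = ((1 / 2 : ℝ) • (u * rho (A * m) + rho (m * A) * u) :
      Matrix (Fin 2) (Fin 2) ℂ) := by
  have h1 : ∀ X : Matrix (Fin 2) (Fin 2) ℂ,
      α (mulR X m) = 2 * (Matrix.trace (A * m * X)).im := fun X => by
    rw [mul_assoc]; exact hα _
  have h2 : ∀ X : Matrix (Fin 2) (Fin 2) ℂ,
      α (mulL X m) = 2 * (Matrix.trace (m * A * X)).im := fun X => by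
    rw [mul_assoc, Matrix.trace_mul_comm, mul_assoc]; exact hα _
  rw [rho_eq_sum, rho_eq_sum, Finset.mul_sum, Finset.sum_mul, ← Finset.sum_add_distrib,
    Finset.smul_sum]
  unfold linHam
  rw [Fintype.sum_sum_type, ← Finset.sum_add_distrib]
  refine Finset.sum_congr rfl fun i _ => ?_
  have v1 : α (dblV (Sum.inl i) m) =
      1 / 2 * (2 * (Matrix.trace (A * m * (sbBasis i : Matrix (Fin 2) (Fin 2) ℂ))).im) :=
    (map_smul α (1 / 2 : ℝ) (mulR (sbBasis i) m)).trans (congrArg _ (h1 _))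
  have v2 : α (dblV (Sum.inr i) m) =
      1 / 2 * (2 * (Matrix.trace (m * A * (sbBasis i : Matrix (Fin 2) (Fin 2) ℂ))).im) :=
    (map_smul α (1 / 2 : ℝ) (mulL (sbBasis i) m)).trans (congrArg _ (h2 _))
  have w1 : α (dblW (Sum.inl i) m) =
      2 * (Matrix.trace (A * m * (suBasis i : Matrix (Fin 2) (Fin 2) ℂ))).im := h1 _
  have w2 : α (dblW (Sum.inr i) m) =
      2 * (Matrix.trace (m * A * (suBasis i : Matrix (Fin 2) (Fin 2) ℂ))).im := h2 _
  rw [v1, v2, w1, w2]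
  simp only [mul_sub, sub_mul, Matrix.mul_smul, Matrix.smul_mul]
  have key : ∀ (a b c d : ℝ) (P Q R S : Matrix (Fin 2) (Fin 2) ℂ),
      ((1 / 2 * (2 * a)) • P - (2 * b) • (1 / 2 : ℝ) • Q)
        + ((1 / 2 * (2 * c)) • R - (2 * d) • (1 / 2 : ℝ) • S)
      = (1 / 2 : ℝ) • (((2 * a) • P - (2 * b) • Q) + ((2 * c) • R - (2 * d) • S)) := by
    intros
    module
  exact key _ _ _ _ _ _ _ _

/-- The modified classical Yang–Baxter equation for `rho`, paired with a third element. -/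
theorem trace_rho_rho (P Q S : Matrix (Fin 2) (Fin 2) ℂ) :
    (Matrix.trace (S * (rho P * rho Q))).im - (Matrix.trace (S * (rho Q * rho P))).im
      + ((Matrix.trace (P * (rho Q * rho S))).im - (Matrix.trace (P * (rho S * rho Q))).im)
      + ((Matrix.trace (Q * (rho S * rho P))).im - (Matrix.trace (Q * (rho P * rho S))).im)
      = (Matrix.trace (S * (Q * P))).im - (Matrix.trace (S * (P * Q))).im := by
  simp [rho, Matrix.trace_fin_two, Matrix.mul_apply, Fin.sum_univ_two]
  ring

/-- The terms mixing left and right fields cancel, since left and right multiplications commute. The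
pure terms are the left-hand sides of the Yang–Baxter identity for Am, Bm, Cm and for mA, mB, mC,
with opposite signs; their right-hand sides coincide by cyclicity of the trace. -/
theorem dbl_algebraic_jacobi (m : Matrix (Fin 2) (Fin 2) ℂ) (α β γ : Amb →L[ℝ] ℝ) :
    linBivecDeriv dblV dblW m (linHam dblV dblW m m α) β γ
      + linBivecDeriv dblV dblW m (linHam dblV dblW m m β) γ α
      + linBivecDeriv dblV dblW m (linHam dblV dblW m m γ) α β = 0 := by
  obtain ⟨A, hA⟩ := exists_trace_repr α
  obtain ⟨B, hB⟩ := exists_trace_repr β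
  obtain ⟨C, hC⟩ := exists_trace_repr γ
  have e1 := trace_rho_rho (A * m) (B * m) (C * m)
  have e2 := trace_rho_rho (m * A) (m * B) (m * C)
  have cyc : ∀ X Y : Matrix (Fin 2) (Fin 2) ℂ,
      (Matrix.trace (m * (X * Y))).im = (Matrix.trace (X * (Y * m))).im := fun X Y => by
    rw [Matrix.trace_mul_comm, mul_assoc]
  simp only [linBivecDeriv, linHam_dbl m _ hA, linHam_dbl m _ hB, linHam_dbl m _ hC]
  simp only [hA, hB, hC]
  simp only [mul_add, add_mul, Matrix.mul_smul, Matrix.smul_mul, smul_add, Matrix.trace_add,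
    Matrix.trace_smul, Complex.add_im, Complex.smul_im, mul_assoc, smul_eq_mul] at e1 e2 ⊢
  simp only [cyc, mul_assoc] at e1 e2 ⊢
  linear_combination (1 / 2) * e1 - (1 / 2) * e2

/-! ### The symplectic structure on the double -/

/-- Provides a smooth local extension of the bracket itself, as needed for its smoothness and for
iterated brackets. -/
theorem eventually_bracketD_eq {φ ψ : D → ℝ} {g : D} {F G : Amb → ℝ}
    (hF : ContDiffAt ℝ ∞ F (amb g)) (hφ : ∀ᶠ p in 𝓝 g, φ p = F (amb p))
    (hG : ContDiffAt ℝ ∞ G (amb g)) (hψ : ∀ᶠ p in 𝓝 g, ψ p = G (amb p)) :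
    ∀ᶠ p in 𝓝 g, bracketD φ ψ p =
      linBivec dblV dblW (amb p) (fderiv ℝ F (amb p)) (fderiv ℝ G (amb p)) := by
  have dif : ∀ {F : Amb → ℝ}, ContDiffAt ℝ ∞ F (amb g) →
      ∀ᶠ p in 𝓝 g, DifferentiableAt ℝ F (amb p) := fun {F} h => by
    have h1 : ∀ᶠ m in 𝓝 (amb g), ContDiffAt ℝ 1 F m :=
      (h.of_le (WithTop.coe_le_coe.2 (le_top : (1 : ℕ∞) ≤ ⊤))).eventually (by decide)
    filter_upwards [continuous_amb.continuousAt.eventually h1] with p hp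
    exact hp.differentiableAt (by simp)
  filter_upwards [dif hF, dif hG, hφ.eventually_nhds, hψ.eventually_nhds] with p h1 h2 h3 h4
  exact bracketD_eq h1 h3 h2 h4

theorem smoothD_restrict {F : Amb → ℝ} (hF : ContDiff ℝ ∞ F) : SmoothD fun g => F (amb g) :=
  fun _ => ⟨F, hF.contDiffAt, Filter.Eventually.of_forall fun _ => rfl⟩

theorem bracketD_skew {φ ψ : D → ℝ} (g : D) : bracketD φ ψ g = -bracketD ψ φ g := by
  simp only [bracketD, ← mul_neg, ← Finset.sum_neg_distrib]
  exact congrArg _ (Finset.sum_congr rfl fun i _ => by ring)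

/-- The `su(2)` part of the traceless part of a matrix. -/
def suPart (Z : Matrix (Fin 2) (Fin 2) ℂ) : Matrix (Fin 2) (Fin 2) ℂ :=
  !![(Z 0 0 - Z 1 1 - star (Z 0 0 - Z 1 1)) / 4, -star (Z 1 0);
    Z 1 0, -(Z 0 0 - Z 1 1 - star (Z 0 0 - Z 1 1)) / 4]

/-- The `sb(2,ℂ)` part of the traceless part of a matrix. -/
def sbPart (Z : Matrix (Fin 2) (Fin 2) ℂ) : Matrix (Fin 2) (Fin 2) ℂ :=
  !![(Z 0 0 - Z 1 1 + star (Z 0 0 - Z 1 1)) / 4, Z 0 1 + star (Z 1 0);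
    0, -(Z 0 0 - Z 1 1 + star (Z 0 0 - Z 1 1)) / 4]

theorem two_smul_suPart (Z : Matrix (Fin 2) (Fin 2) ℂ) :
    (2 : ℂ) • suPart Z = Z - (Matrix.trace Z / 2) • (1 : Matrix (Fin 2) (Fin 2) ℂ) + rho Z := by
  ext i j
  fin_cases i <;> fin_cases j <;> simp [suPart, rho, Matrix.trace_fin_two] <;> ring

theorem two_smul_sbPart (Z : Matrix (Fin 2) (Fin 2) ℂ) :
    (2 : ℂ) • sbPart Z = Z - (Matrix.trace Z / 2) • (1 : Matrix (Fin 2) (Fin 2) ℂ) - rho Z := by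
  ext i j
  fin_cases i <;> fin_cases j <;> simp [sbPart, rho, Matrix.trace_fin_two] <;> ring

theorem det_suPart (Z : Matrix (Fin 2) (Fin 2) ℂ) :
    (suPart Z).det.re = ((Z 0 0 - Z 1 1).im / 2) ^ 2 + ((Z 1 0).re ^ 2 + (Z 1 0).im ^ 2) := by
  simp [suPart, Matrix.det_fin_two]
  ring

theorem det_sbPart (Z : Matrix (Fin 2) (Fin 2) ℂ) :
    (sbPart Z).det.re = -((Z 0 0 - Z 1 1).re / 2) ^ 2 := by
  simp [sbPart, Matrix.det_fin_two]
  ring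

/-- With `rho` = su-part minus sb-part, the hypothesis says that g carries the sb-part of Ag to the
su-part of gA and vice versa. As det g = 1, the determinants agree; their real parts have opposite
signs, so both are zero. On su(2) the determinant is definite, so both su-parts vanish. -/
theorem eq_zero_of_rho_conj (g : D) (A : Matrix (Fin 2) (Fin 2) ℂ)
    (h : (g : Matrix (Fin 2) (Fin 2) ℂ) * rho (A * g) + rho (g * A) * g = 0) :
    suPart (A * g) = 0 ∧ sbPart (A * g) = 0 := by
  obtain ⟨g, hg⟩ := g
  change g * rho (A * g) + rho (g * A) * g = 0 at h
  change suPart (A * g) = 0 ∧ sbPart (A * g) = 0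
  have hneg : rho (g * A) * g = -(g * rho (A * g)) := eq_neg_of_add_eq_zero_right h
  have htr : Matrix.trace (g * A) = Matrix.trace (A * g) := Matrix.trace_mul_comm _ _
  have h2 : (2 : ℂ) ≠ 0 := two_ne_zero
  have e1 : suPart (g * A) * g = g * sbPart (A * g) := by
    apply smul_right_injective _ h2
    change (2 : ℂ) • (suPart (g * A) * g) = (2 : ℂ) • (g * sbPart (A * g))
    rw [← Matrix.smul_mul, ← Matrix.mul_smul, two_smul_suPart, two_smul_sbPart]
    rw [add_mul, sub_mul, mul_sub, mul_sub, hneg, htr, mul_assoc]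
    simp [sub_eq_add_neg]
  have e2 : sbPart (g * A) * g = g * suPart (A * g) := by
    apply smul_right_injective _ h2
    change (2 : ℂ) • (sbPart (g * A) * g) = (2 : ℂ) • (g * suPart (A * g))
    rw [← Matrix.smul_mul, ← Matrix.mul_smul, two_smul_suPart, two_smul_sbPart]
    rw [sub_mul, sub_mul, mul_add, mul_sub, hneg, htr, mul_assoc]
    simp [sub_eq_add_neg]
  have d1 := congrArg (fun M => (Matrix.det M).re) e1
  have d2 := congrArg (fun M => (Matrix.det M).re) e2
  simp only [Matrix.det_mul, hg, mul_one, one_mul, det_suPart, det_sbPart] at d1 d2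
  set P := A * g with hP
  set Q := g * A with hQ
  have p1 : (P 0 0 - P 1 1).re = 0 := by nlinarith
  have p2 : (P 0 0 - P 1 1).im = 0 := by nlinarith
  have p3 : (P 1 0).re = 0 := by nlinarith
  have p4 : (P 1 0).im = 0 := by nlinarith
  have q2 : (Q 0 0 - Q 1 1).im = 0 := by nlinarith
  have q3 : (Q 1 0).re = 0 := by nlinarith
  have q4 : (Q 1 0).im = 0 := by nlinarith
  have su0 : ∀ Z : Matrix (Fin 2) (Fin 2) ℂ, (Z 0 0 - Z 1 1).im = 0 → (Z 1 0).re = 0 →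
      (Z 1 0).im = 0 → suPart Z = 0 := fun Z h1 h2 h3 => by
    have h4 : Z 1 0 = 0 := Complex.ext h2 h3
    have h5 : star (Z 0 0 - Z 1 1) = Z 0 0 - Z 1 1 := Complex.conj_eq_iff_im.2 h1
    ext i j
    fin_cases i <;> fin_cases j <;> simp [suPart, h4, -star_sub, h5]
  refine ⟨su0 P p2 p3 p4, ?_⟩
  -- The determinant does not see the nilpotent corner of the sb-part of P, so that part is
  -- recovered from `e1` by inverting g.
  rw [su0 Q q2 q3 q4, zero_mul] at e1
  calc sbPart P = (g.adjugate * g) * sbPart P := by rw [Matrix.adjugate_mul, hg, one_smul, one_mul]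
    _ = 0 := by rw [mul_assoc, ← e1, mul_zero]

theorem eq_zero_of_forall_clm {u : Amb} (h : ∀ γ : Amb →L[ℝ] ℝ, γ u = 0) : u = 0 :=
  SeparatingDual.eq_zero_of_forall_dual_eq_zero h

/-- The kernel of the bivector in the ambient space is conormal to `D`: both parts of Ag vanish, so
Ag is scalar, and a scalar matrix has zero trace pairing with sl(2,ℂ). -/
theorem leftDer_eq_zero_of_linHam {α : Amb →L[ℝ] ℝ} {g : D}
    (h : linHam dblV dblW (amb g) (amb g) α = 0) (X : sl2) : α (mulR X (amb g)) = 0 := by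
  obtain ⟨A, hA⟩ := exists_trace_repr α
  have h1 := linHam_dbl g g hA
  have h2 : (g : Matrix (Fin 2) (Fin 2) ℂ) * rho (A * g) + rho (g * A) * g = 0 := by
    have h3 : ((1 / 2 : ℝ) • ((g : Matrix (Fin 2) (Fin 2) ℂ) * rho (A * g) + rho (g * A) * g) :
      Matrix (Fin 2) (Fin 2) ℂ) = 0 := h1.symm.trans h
    exact (smul_eq_zero.1 h3).resolve_left (by norm_num)
  obtain ⟨h3, h4⟩ := eq_zero_of_rho_conj g A h2
  have h5 := two_smul_suPart (A * g)
  have h6 := two_smul_sbPart (A * g)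
  rw [h3, smul_zero] at h5
  rw [h4, smul_zero] at h6
  set P := A * (g : Matrix (Fin 2) (Fin 2) ℂ) with hP
  set c := Matrix.trace P / 2
  have h7 : P = c • (1 : Matrix (Fin 2) (Fin 2) ℂ) := by
    have h8 : (2 : ℂ) • (P - c • (1 : Matrix (Fin 2) (Fin 2) ℂ)) = 0 := by
      have h9 : (2 : ℂ) • (P - c • (1 : Matrix (Fin 2) (Fin 2) ℂ)) =
          (P - c • (1 : Matrix (Fin 2) (Fin 2) ℂ) + rho P)
            + (P - c • (1 : Matrix (Fin 2) (Fin 2) ℂ) - rho P) := by module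
      rw [h9, ← h5, ← h6, add_zero]
    exact sub_eq_zero.1 ((smul_eq_zero.1 h8).resolve_left two_ne_zero)
  have h8 : α (mulR X (amb g)) =
      2 * (Matrix.trace (A * ((g : Matrix (Fin 2) (Fin 2) ℂ) * (X : Matrix (Fin 2) (Fin 2) ℂ)))).im :=
    hA _
  rw [h8, ← mul_assoc, ← hP, h7, Matrix.smul_mul, one_mul, Matrix.trace_smul, trace_sl2]
  simp

theorem isSymplecticBracket_bracketD : IsSymplecticBracket bracketD where
  smooth φ ψ hφ hψ g := by
    obtain ⟨F, hF, hφF⟩ := hφ g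
    obtain ⟨G, hG, hψG⟩ := hψ g
    exact ⟨_, contDiffAt_linBivec dblV dblW hF hG, eventually_bracketD_eq hF hφF hG hψG⟩
  skew φ ψ _ _ g := bracketD_skew g
  linear a φ χ ψ hφ hχ hψ g := by
    obtain ⟨F, hF, hφF⟩ := hφ g
    obtain ⟨H, hH, hχH⟩ := hχ g
    obtain ⟨G, hG, hψG⟩ := hψ g
    replace hF := hF.differentiableAt (by simp)
    replace hH := hH.differentiableAt (by simp)
    replace hG := hG.differentiableAt (by simp)
    have hd := ((hF.hasFDerivAt.const_mul a).add hH.hasFDerivAt)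
    rw [bracketD_eq hF hφF hG hψG, bracketD_eq hH hχH hG hψG,
      bracketD_eq (F := fun m => a * F m + H m) hd.differentiableAt
        (by filter_upwards [hφF, hχH] with p h1 h2; rw [h1, h2]) hG hψG]
    have hd' : fderiv ℝ (fun m => a * F m + H m) (amb g) = _ := hd.fderiv
    rw [hd', linBivec, linBivec, linBivec, Finset.mul_sum, ← Finset.sum_add_distrib]
    refine Finset.sum_congr rfl fun i _ => ?_
    simp
    ring
  leibniz φ χ ψ hφ hχ hψ g := by
    obtain ⟨F, hF, hφF⟩ := hφ g
    obtain ⟨H, hH, hχH⟩ := hχ g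
    obtain ⟨G, hG, hψG⟩ := hψ g
    replace hF := hF.differentiableAt (by simp)
    replace hH := hH.differentiableAt (by simp)
    replace hG := hG.differentiableAt (by simp)
    have hd := hF.hasFDerivAt.mul hH.hasFDerivAt
    rw [bracketD_eq hF hφF hG hψG, bracketD_eq hH hχH hG hψG,
      bracketD_eq (F := fun m => F m * H m) hd.differentiableAt
        (by filter_upwards [hφF, hχH] with p h1 h2; rw [h1, h2]) hG hψG,
      hφF.self_of_nhds, hχH.self_of_nhds]
    have hd' : fderiv ℝ (fun m => F m * H m) (amb g) = _ := hd.fderiv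
    rw [hd', linBivec, linBivec, linBivec, Finset.mul_sum, Finset.sum_mul,
      ← Finset.sum_add_distrib]
    refine Finset.sum_congr rfl fun i _ => ?_
    simp
    ring
  jacobi φ χ ψ hφ hχ hψ g := by
    obtain ⟨F, hF, hφF⟩ := hφ g
    obtain ⟨H, hH, hχH⟩ := hχ g
    obtain ⟨G, hG, hψG⟩ := hψ g
    have key := linBivec_jacobi dblV dblW (amb g) (dbl_algebraic_jacobi (amb g)) hF hH hG
    have br : ∀ {φ χ ψ : D → ℝ} {F H G : Amb → ℝ}, ContDiffAt ℝ ∞ F (amb g) →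
        (∀ᶠ p in 𝓝 g, φ p = F (amb p)) → ContDiffAt ℝ ∞ H (amb g) →
        (∀ᶠ p in 𝓝 g, χ p = H (amb p)) → ContDiffAt ℝ ∞ G (amb g) →
        (∀ᶠ p in 𝓝 g, ψ p = G (amb p)) → bracketD φ (bracketD χ ψ) g =
          linBivec dblV dblW (amb g) (fderiv ℝ F (amb g)) (fderiv ℝ (fun m =>
            linBivec dblV dblW m (fderiv ℝ H m) (fderiv ℝ G m)) (amb g)) :=
      fun hF hφF hH hχH hG hψG =>
        bracketD_eq (hF.differentiableAt (by simp)) hφF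
          ((contDiffAt_linBivec dblV dblW hH hG).differentiableAt (by simp))
          (eventually_bracketD_eq hH hχH hG hψG)
    rw [br hF hφF hH hχH hG hψG, br hH hχH hG hψG hF hφF, br hG hψG hF hφF hH hχH]
    exact key
  nondegenerate φ hφ g h X := by
    obtain ⟨F, hF, hφF⟩ := hφ g
    replace hF := hF.differentiableAt (by simp)
    rw [leftDer_eq hF hφF]
    -- Real linear functionals of the matrix entries suffice as test functions: they detect every
    -- nonzero ambient vector.
    refine leftDer_eq_zero_of_linHam (eq_zero_of_forall_clm fun γ => ?_) X
    have h1 := h _ (smoothD_restrict γ.contDiff)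
    rw [bracketD_eq hF hφF γ.differentiableAt (Filter.Eventually.of_forall fun _ => rfl),
      γ.fderiv] at h1
    rwa [apply_linHam]

/-! ### The projection `π₁` in coordinates -/

/-- The squared norm of the second row. -/
def rowNorm (m : Amb) : ℝ := Complex.normSq (m 1 0) + Complex.normSq (m 1 1)

/-- The Hermitian product of the two rows. -/
def rowCross (m : Amb) : ℂ := m 0 0 * star (m 1 0) + m 0 1 * star (m 1 1)

/-- The coordinates of `π₁`, on the ambient space. -/
def projCoords (m : Amb) : Fin 3 → ℝ :=
  ![(rowCross m).re / √(rowNorm m), (rowCross m).im / √(rowNorm m), Real.log (rowNorm m)]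

theorem leftProj_eq (g : D) : leftProj g = ofCoords (projCoords (amb g)) := by
  have h : 0 ≤ rowNorm (amb g) := add_nonneg (Complex.normSq_nonneg _) (Complex.normSq_nonneg _)
  refine congrArg ofCoords (funext fun i => ?_)
  fin_cases i
  · exact Complex.div_ofReal_re _ _
  · exact Complex.div_ofReal_im _ _
  · change 2 * Real.log √(rowNorm (amb g)) = Real.log (rowNorm (amb g))
    rw [Real.log_sqrt h]
    ring

theorem coords_leftProj (g : D) : coords (leftProj g) = projCoords (amb g) := by
  rw [leftProj_eq, coords_ofCoords]

theorem rowNorm_pos (g : D) : 0 < rowNorm (amb g) := by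
  rcases (add_nonneg (Complex.normSq_nonneg (g 1 0)) (Complex.normSq_nonneg (g 1 1))).lt_or_eq
    with h | h
  · exact h
  · have h0 : g 1 0 = 0 := Complex.normSq_eq_zero.1 (by
      linarith [Complex.normSq_nonneg (g 1 0), Complex.normSq_nonneg (g 1 1)])
    have h1 : g 1 1 = 0 := Complex.normSq_eq_zero.1 (by
      linarith [Complex.normSq_nonneg (g 1 0), Complex.normSq_nonneg (g 1 1)])
    have hd := g.det_coe
    rw [Matrix.det_fin_two, h0, h1] at hd
    simp at hd

theorem contDiff_entry_re (i j : Fin 2) : ContDiff ℝ ∞ fun m : Amb => (m i j).re :=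
  Complex.reCLM.contDiff.comp (contDiff_apply_apply ℝ ℂ i j)

theorem contDiff_entry_im (i j : Fin 2) : ContDiff ℝ ∞ fun m : Amb => (m i j).im :=
  Complex.imCLM.contDiff.comp (contDiff_apply_apply ℝ ℂ i j)

theorem contDiff_rowNorm : ContDiff ℝ ∞ rowNorm := by
  have h : rowNorm = fun m : Amb => ((m 1 0).re * (m 1 0).re + (m 1 0).im * (m 1 0).im)
      + ((m 1 1).re * (m 1 1).re + (m 1 1).im * (m 1 1).im) := by
    funext m
    simp [rowNorm, Complex.normSq_apply]
  rw [h]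
  have hr := contDiff_entry_re
  have hi := contDiff_entry_im
  fun_prop

theorem contDiff_rowCross_re : ContDiff ℝ ∞ fun m => (rowCross m).re := by
  have h : (fun m => (rowCross m).re) = fun m : Amb =>
      ((m 0 0).re * (m 1 0).re + (m 0 0).im * (m 1 0).im)
      + ((m 0 1).re * (m 1 1).re + (m 0 1).im * (m 1 1).im) := by
    funext m
    simp [rowCross]
  rw [h]
  have hr := contDiff_entry_re
  have hi := contDiff_entry_im
  fun_prop

theorem contDiff_rowCross_im : ContDiff ℝ ∞ fun m => (rowCross m).im := by
  have h : (fun m => (rowCross m).im) = fun m : Amb =>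
      ((m 0 0).im * (m 1 0).re - (m 0 0).re * (m 1 0).im)
      + ((m 0 1).im * (m 1 1).re - (m 0 1).re * (m 1 1).im) := by
    funext m
    simp [rowCross]
    ring
  rw [h]
  have hr := contDiff_entry_re
  have hi := contDiff_entry_im
  fun_prop

theorem contDiffAt_projCoords {m : Amb} (hm : 0 < rowNorm m) :
    ContDiffAt ℝ ∞ projCoords m := by
  have hs : ContDiffAt ℝ ∞ (fun m => √(rowNorm m)) m := contDiff_rowNorm.contDiffAt.sqrt hm.ne'
  refine contDiffAt_pi.2 fun i => ?_
  fin_cases i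
  · exact contDiff_rowCross_re.contDiffAt.div hs (Real.sqrt_pos.2 hm).ne'
  · exact contDiff_rowCross_im.contDiffAt.div hs (Real.sqrt_pos.2 hm).ne'
  · exact contDiff_rowNorm.contDiffAt.log hm.ne'

theorem hasDerivAt_line (m Y : Amb) : HasDerivAt (fun t : ℝ => m + t • Y) Y 0 := by
  simpa using ((hasDerivAt_id (0 : ℝ)).smul_const Y).const_add m

theorem hasDerivAt_rowNorm (m Y : Amb) :
    HasDerivAt (fun t : ℝ => rowNorm (m + t • Y))
      (2 * (star (m 1 0) * Y 1 0 + star (m 1 1) * Y 1 1).re) 0 := by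
  have h : (fun t : ℝ => rowNorm (m + t • Y)) = fun t : ℝ => rowNorm m
      + (t * (2 * (star (m 1 0) * Y 1 0 + star (m 1 1) * Y 1 1).re) + t ^ 2 * rowNorm Y) := by
    funext t
    simp [rowNorm, Complex.normSq_apply]
    ring
  rw [h]
  simpa using (((hasDerivAt_id (0 : ℝ)).mul_const _).add
    (((hasDerivAt_id (0 : ℝ)).pow 2).mul_const (rowNorm Y))).const_add (rowNorm m)

/-- The derivative of `rowCross`. -/
def rowCrossDeriv (m Y : Amb) : ℂ :=
  m 0 0 * star (Y 1 0) + Y 0 0 * star (m 1 0) + (m 0 1 * star (Y 1 1) + Y 0 1 * star (m 1 1))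

theorem hasDerivAt_rowCross (m Y : Amb) :
    HasDerivAt (fun t : ℝ => (rowCross (m + t • Y)).re) (rowCrossDeriv m Y).re 0 ∧
      HasDerivAt (fun t : ℝ => (rowCross (m + t • Y)).im) (rowCrossDeriv m Y).im 0 := by
  constructor
  · have h : (fun t : ℝ => (rowCross (m + t • Y)).re) = fun t : ℝ => (rowCross m).re
        + (t * (rowCrossDeriv m Y).re + t ^ 2 * (rowCross Y).re) := by
      funext t
      simp [rowCross, rowCrossDeriv]
      ring
    rw [h]
    simpa using (((hasDerivAt_id (0 : ℝ)).mul_const _).add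
      (((hasDerivAt_id (0 : ℝ)).pow 2).mul_const (rowCross Y).re)).const_add (rowCross m).re
  · have h : (fun t : ℝ => (rowCross (m + t • Y)).im) = fun t : ℝ => (rowCross m).im
        + (t * (rowCrossDeriv m Y).im + t ^ 2 * (rowCross Y).im) := by
      funext t
      simp [rowCross, rowCrossDeriv]
      ring
    rw [h]
    simpa using (((hasDerivAt_id (0 : ℝ)).mul_const _).add
      (((hasDerivAt_id (0 : ℝ)).pow 2).mul_const (rowCross Y).im)).const_add (rowCross m).im

/-- Computed along the line m + tY, where `rowNorm` and `rowCross` are quadratic in t. The variables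
`s`, `d`, `n'` come with equations so that simplified values can be supplied for a particular
direction Y. -/
theorem fderiv_projCoords {m : Amb} (hm : 0 < rowNorm m) (Y : Amb) {s d : ℝ} {n' : ℂ}
    (hs : s = √(rowNorm m)) (hd : d = 2 * (star (m 1 0) * Y 1 0 + star (m 1 1) * Y 1 1).re)
    (hn' : n' = rowCrossDeriv m Y) :
    fderiv ℝ projCoords m Y =
      ![(n'.re - projCoords m 0 * (d / (2 * s))) / s,
        (n'.im - projCoords m 1 * (d / (2 * s))) / s, d / s ^ 2] := by
  have hspos : 0 < s := hs ▸ Real.sqrt_pos.2 hm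
  have hm0 : m + (0 : ℝ) • Y = m := by simp
  have hm' : 0 < rowNorm (m + (0 : ℝ) • Y) := by rwa [hm0]
  have h1 := ((contDiffAt_projCoords hm').differentiableAt (by simp)).hasFDerivAt.comp_hasDerivAt
    0 (hasDerivAt_line m Y)
  rw [hm0] at h1
  refine h1.unique (hasDerivAt_pi.2 fun i => ?_)
  have hN := hasDerivAt_rowNorm m Y
  rw [← hd] at hN
  obtain ⟨hR, hI⟩ := hasDerivAt_rowCross m Y
  rw [← hn'] at hR hI
  have hS := hN.sqrt hm'.ne'
  have hS0 : √(rowNorm (m + (0 : ℝ) • Y)) ≠ 0 := (Real.sqrt_pos.2 hm').ne'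
  have hL := hN.log hm'.ne'
  have hdR := hR.fun_div hS hS0
  have hdI := hI.fun_div hS hS0
  rw [hm0, ← hs] at hdR hdI
  rw [hm0, ← Real.sq_sqrt hm.le, ← hs] at hL
  fin_cases i
  · have hp : projCoords m 0 = (rowCross m).re / s := by rw [hs]; rfl
    change HasDerivAt _ ((n'.re - projCoords m 0 * (d / (2 * s))) / s) 0
    refine hdR.congr_deriv ?_
    rw [hp]
    field_simp
  · have hp : projCoords m 1 = (rowCross m).im / s := by rw [hs]; rfl
    change HasDerivAt _ ((n'.im - projCoords m 1 * (d / (2 * s))) / s) 0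
    refine hdI.congr_deriv ?_
    rw [hp]
    field_simp
  · exact hL

theorem diffSB_apply (f : SB → ℝ) (b : SB) (v : Fin 3 → ℝ) :
    diffSB f b v = v 0 * partialSB 0 f b + v 1 * partialSB 1 f b + v 2 * partialSB 2 f b := by
  have h : v = ∑ i, v i • (Pi.single i 1 : Fin 3 → ℝ) := by
    simpa using (pi_eq_sum_univ' v)
  conv_lhs => rw [h, map_sum]
  simp [Fin.sum_univ_three, partialSB]

theorem contDiffAt_pullback {f : SB → ℝ} (hf : SmoothSB f) (g : D) :
    ContDiffAt ℝ ∞ (fun m => f (ofCoords (projCoords m))) (amb g) :=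
  (ContDiff.contDiffAt hf).comp (amb g) (contDiffAt_projCoords (rowNorm_pos g))

theorem eventually_pullback (f : SB → ℝ) (g : D) :
    ∀ᶠ p in 𝓝 g, f (leftProj p) = f (ofCoords (projCoords (amb p))) :=
  Filter.Eventually.of_forall fun p => by rw [leftProj_eq]

theorem smoothD_leftProj {f : SB → ℝ} (hf : SmoothSB f) : SmoothD fun g => f (leftProj g) :=
  fun g => ⟨_, contDiffAt_pullback hf g, eventually_pullback f g⟩

theorem fderiv_pullback {f : SB → ℝ} (hf : SmoothSB f) (g : D) (Y : Amb) :
    fderiv ℝ (fun m => f (ofCoords (projCoords m))) (amb g) Y =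
      diffSB f (leftProj g) (fderiv ℝ projCoords (amb g) Y) := by
  have h1 := ((contDiffAt_projCoords (rowNorm_pos g)).differentiableAt (by simp)).hasFDerivAt
  have h2 : HasFDerivAt (fun v => f (ofCoords v)) (diffSB f (leftProj g)) (projCoords (amb g)) := by
    rw [diffSB, coords_leftProj]
    exact (ContDiff.differentiable hf (by simp) _).hasFDerivAt
  have h3 : HasFDerivAt (fun m => f (ofCoords (projCoords m))) _ (amb g) := h2.comp _ h1
  rw [h3.fderiv]
  rfl

theorem rightDer_leftProj {f : SB → ℝ} (hf : SmoothSB f) (g : D) (X : sl2) :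
    rightDer (fun p => f (leftProj p)) g X =
      diffSB f (leftProj g) (fderiv ℝ projCoords (amb g) (mulL X (amb g))) := by
  rw [rightDer_eq ((contDiffAt_pullback hf g).differentiableAt (by simp))
    (eventually_pullback f g), fderiv_pullback hf]

theorem leftDer_leftProj {f : SB → ℝ} (hf : SmoothSB f) (g : D) (X : sl2) :
    leftDer (fun p => f (leftProj p)) g X =
      diffSB f (leftProj g) (fderiv ℝ projCoords (amb g) (mulR X (amb g))) := by
  rw [leftDer_eq ((contDiffAt_pullback hf g).differentiableAt (by simp))
    (eventually_pullback f g), fderiv_pullback hf]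

/-- Infinitesimal SU(2)-invariance of π₁: right multiplication by a unitary matrix preserves the
Hermitian products of the rows, so `rowNorm` and `rowCross` have derivative zero. -/
theorem leftDer_leftProj_su {f : SB → ℝ} (hf : SmoothSB f) (g : D) (i : Fin 3) :
    leftDer (fun p => f (leftProj p)) g (suBasis i) = 0 := by
  rw [leftDer_leftProj hf, fderiv_projCoords (rowNorm_pos g) _ (d := 0) (n' := 0) rfl]
  · rw [diffSB_apply]
    simp
  · fin_cases i <;>
      simp [mulR_apply, suBasis, mkSl2, Matrix.mul_apply, Fin.sum_univ_two] <;> ring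
  · fin_cases i <;> apply Complex.ext <;>
      simp [rowCrossDeriv, mulR_apply, suBasis, mkSl2, Matrix.mul_apply, Fin.sum_univ_two] <;> ring

/-- The relation between the Hermitian products of the rows and the determinant. -/
theorem row_gram (g : D) : (Complex.normSq (g 0 0) + Complex.normSq (g 0 1)) * rowNorm (amb g)
    = 1 + ((rowCross (amb g)).re ^ 2 + (rowCross (amb g)).im ^ 2) := by
  have hd := g.det_coe
  rw [Matrix.det_fin_two] at hd
  -- Lagrange's identity: the product of the squared row norms is |det|² plus the squared modulus of
  -- the Hermitian product, and det = 1.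
  have h1 := congrArg Complex.normSq hd
  rw [map_one, Complex.normSq_apply] at h1
  simp only [Complex.sub_re, Complex.mul_re, Complex.sub_im, Complex.mul_im] at h1
  simp [rowNorm, rowCross, Complex.normSq_apply]
  linear_combination h1

theorem exists_polar (g : D) : ∃ s x y : ℝ, 0 < s ∧ s ^ 2 = rowNorm (amb g) ∧
    s = √(rowNorm (amb g)) ∧ projCoords (amb g) = ![x, y, Real.log (s ^ 2)] ∧
    rowCross (amb g) = ⟨s * x, s * y⟩ := by
  have hs := Real.sqrt_pos.2 (rowNorm_pos g)
  have hs2 := Real.sq_sqrt (rowNorm_pos g).le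
  refine ⟨√(rowNorm (amb g)), _, _, hs, hs2, rfl, by rw [hs2]; rfl, ?_⟩
  apply Complex.ext
  · exact (mul_div_cancel₀ _ hs.ne').symm
  · exact (mul_div_cancel₀ _ hs.ne').symm

/-- Left multiplication descends along π₁, so the answer depends only on π₁(g), that is, on s, x, y.
The only other quantity that enters, the norm of the first row, is eliminated by `row_gram`. -/
theorem fderiv_projCoords_right (g : D) {s x y z : ℝ} (a b c : ℂ) (hs0 : 0 < s)
    (hs2 : s ^ 2 = rowNorm (amb g)) (hs : s = √(rowNorm (amb g)))
    (hv : projCoords (amb g) = ![x, y, z]) (hN : rowCross (amb g) = ⟨s * x, s * y⟩) :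
    fderiv ℝ projCoords (amb g) (mulL (mkSl2 a b c) (amb g)) =
      ![(c.re * (1 + s ^ 2 * (x ^ 2 + y ^ 2)) / s ^ 2 - 2 * a.im * y * s + b.re * s ^ 2
            - x * (c.re * x - c.im * y - a.re * s)) / s,
        (-c.im * (1 + s ^ 2 * (x ^ 2 + y ^ 2)) / s ^ 2 + 2 * a.im * x * s + b.im * s ^ 2
            - y * (c.re * x - c.im * y - a.re * s)) / s,
        2 * (c.re * x - c.im * y) / s - 2 * a.re] := by
  have hG := row_gram g
  rw [hN, ← hs2] at hG
  set G := Complex.normSq (g 0 0) + Complex.normSq (g 0 1) with hGdef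
  have hG' : G = (1 + s ^ 2 * (x ^ 2 + y ^ 2)) / s ^ 2 := by
    field_simp
    linear_combination hG
  have hNre : (rowCross (amb g)).re = s * x := by rw [hN]
  have hNim : (rowCross (amb g)).im = s * y := by rw [hN]
  rw [hGdef] at hG'
  simp only [rowCross, rowNorm, Complex.normSq_apply, Complex.add_re, Complex.add_im,
    Complex.mul_re, Complex.mul_im, Complex.star_def, Complex.conj_re, Complex.conj_im]
    at hNre hNim hG' hs2
  rw [fderiv_projCoords (rowNorm_pos g) _ (d := 2 * s * (c.re * x - c.im * y - a.re * s))
    (n' := ⟨c.re * ((1 + s ^ 2 * (x ^ 2 + y ^ 2)) / s ^ 2) - 2 * a.im * y * s + b.re * s ^ 2,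
      -c.im * ((1 + s ^ 2 * (x ^ 2 + y ^ 2)) / s ^ 2) + 2 * a.im * x * s + b.im * s ^ 2⟩) hs, hv]
  · funext i
    fin_cases i <;> simp <;> field_simp
  · simp [mulL_apply, mkSl2, Matrix.mul_apply, Fin.sum_univ_two]
    linear_combination 2 * (-c.re * hNre + c.im * hNim - a.re * hs2)
  · rw [← hG']
    apply Complex.ext
    · simp [rowCrossDeriv, mulL_apply, mkSl2, Matrix.mul_apply, Fin.sum_univ_two]
      linear_combination 2 * a.im * hNim + b.re * hs2
    · simp [rowCrossDeriv, mulL_apply, mkSl2, Matrix.mul_apply, Fin.sum_univ_two]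
      linear_combination -2 * a.im * hNre + b.im * hs2

/-- Each term of r^L contains a derivative along su(2), hence vanishes. The r^R part is an identity
of rational functions in s, x, y once sinh z is written with exp z = s². -/
theorem bracketD_leftProj {f h : SB → ℝ} (hf : SmoothSB f) (hh : SmoothSB h) (g : D) :
    bracketD (fun p => f (leftProj p)) (fun p => h (leftProj p)) g =
      bracketSB f h (leftProj g) := by
  obtain ⟨s, x, y, hs0, hs2, hs, hv, hN⟩ := exists_polar g
  have hsinh : Real.sinh (Real.log (s ^ 2)) = (s ^ 2 - (s ^ 2)⁻¹) / 2 := by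
    rw [Real.sinh_eq, Real.exp_neg, Real.exp_log (by positivity)]
  simp only [bracketD, leftDer_leftProj_su hf, leftDer_leftProj_su hh, mul_zero, zero_mul,
    sub_zero, zero_add]
  simp only [rightDer_leftProj hf, rightDer_leftProj hh, bracketSB, coords_leftProj, hv,
    Fin.sum_univ_three, suBasis, sbBasis,
    Matrix.cons_val_zero, Matrix.cons_val_one, Matrix.cons_val,
    fderiv_projCoords_right g _ _ _ hs0 hs2 hs hv hN, diffSB_apply, hsinh]
  generalize partialSB 0 f (leftProj g) = f0
  generalize partialSB 1 f (leftProj g) = f1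
  generalize partialSB 2 f (leftProj g) = f2
  generalize partialSB 0 h (leftProj g) = h0
  generalize partialSB 1 h (leftProj g) = h1
  generalize partialSB 2 h (leftProj g) = h2
  simp
  field_simp
  ring

/-- `π₁` is a submersion: a function with `d(f ∘ π₁) = 0` at `g` has `df = 0` at `π₁(g)`. -/
theorem diffSB_eq_zero_of_rightDer {f : SB → ℝ} (hf : SmoothSB f) (g : D)
    (h : ∀ i, rightDer (fun p => f (leftProj p)) g (sbBasis i) = 0) :
    diffSB f (leftProj g) = 0 := by
  obtain ⟨s, x, y, hs0, hs2, hs, hv, hN⟩ := exists_polar g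
  have h0 := h 0
  have h1 := h 1
  have h2 := h 2
  simp only [rightDer_leftProj hf, sbBasis, Matrix.cons_val_zero, Matrix.cons_val_one,
    Matrix.cons_val, fderiv_projCoords_right g _ _ _ hs0 hs2 hs hv hN, diffSB_apply] at h0 h1 h2
  -- The system is triangular: the first two directions of sb(2,ℂ) move only x and only y, and the
  -- third moves z at a nonzero rate.
  simp [hs0.ne'] at h0 h1 h2
  simp [h0, h1] at h2
  ext v
  rw [diffSB_apply, h0, h1, h2]
  simp

/-! ### The anti-automorphism exchanging the two projections -/

/-- The anti-automorphism of `SL(2,ℂ)` exchanging the diagonal entries. -/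
def flipD (g : D) : D :=
  ⟨!![g 1 1, g 0 1; g 1 0, g 0 0], by
    have h := g.det_coe
    rw [Matrix.det_fin_two] at h
    rw [Matrix.det_fin_two_of]
    linear_combination h⟩

/-- The exchange of the diagonal entries of a matrix. -/
def flipAmb : Amb →L[ℝ] Amb :=
  LinearMap.toContinuousLinearMap
    { toFun := fun m => !![m 1 1, m 0 1; m 1 0, m 0 0]
      map_add' := by
        intro m n
        funext i j
        fin_cases i <;> fin_cases j <;> rfl
      map_smul' := by
        intro c m
        funext i j
        fin_cases i <;> fin_cases j <;> rfl }

theorem flipAmb_amb (g : D) : flipAmb (amb g) = amb (flipD g) := rfl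

theorem continuous_flipD : Continuous flipD := by
  have h : Topology.IsInducing (fun g : D => (g : Matrix (Fin 2) (Fin 2) ℂ)) := ⟨rfl⟩
  exact h.continuous_iff.2 (flipAmb.continuous.comp continuous_amb)

theorem SmoothD.comp_flipD {φ : D → ℝ} (hφ : SmoothD φ) : SmoothD fun g => φ (flipD g) := by
  intro g
  obtain ⟨F, hF, h⟩ := hφ (flipD g)
  exact ⟨fun m => F (flipAmb m), ContDiffAt.comp (amb g) hF flipAmb.contDiff.contDiffAt,
    continuous_flipD.continuousAt.eventually h⟩

/-- The signs of the basis vectors under the exchange of the diagonal entries. -/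
def flipSign : Fin 3 → ℝ := ![1, 1, -1]

theorem mulR_entry (X : Matrix (Fin 2) (Fin 2) ℂ) (m : Amb) (i j : Fin 2) :
    mulR X m i j = m i 0 * X 0 j + m i 1 * X 1 j :=
  Fin.sum_univ_two fun k => m i k * X k j

theorem mulL_entry (X : Matrix (Fin 2) (Fin 2) ℂ) (m : Amb) (i j : Fin 2) :
    mulL X m i j = X i 0 * m 0 j + X i 1 * m 1 j :=
  Fin.sum_univ_two fun k => X i k * m k j

theorem flipAmb_entry (m : Amb) (i j : Fin 2) : flipAmb m i j = m (1 - j) (1 - i) := by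
  fin_cases i <;> fin_cases j <;> rfl

theorem flipAmb_mulR_su (m : Amb) (i : Fin 3) :
    flipAmb (mulR (suBasis i) m) = flipSign i • mulL (suBasis i) (flipAmb m) := by
  funext k l
  fin_cases i <;> fin_cases k <;> fin_cases l <;>
    simp [flipAmb_entry, mulR_entry, mulL_entry, suBasis, mkSl2, flipSign] <;> ring

theorem flipAmb_mulR_sb (m : Amb) (i : Fin 3) :
    flipAmb (mulR (sbBasis i) m) = flipSign i • mulL (sbBasis i) (flipAmb m) := by
  funext k l
  fin_cases i <;> fin_cases k <;> fin_cases l <;>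
    simp [flipAmb_entry, mulR_entry, mulL_entry, sbBasis, mkSl2, flipSign] <;> ring

theorem flipAmb_mulL_su (m : Amb) (i : Fin 3) :
    flipAmb (mulL (suBasis i) m) = flipSign i • mulR (suBasis i) (flipAmb m) := by
  funext k l
  fin_cases i <;> fin_cases k <;> fin_cases l <;>
    simp [flipAmb_entry, mulR_entry, mulL_entry, suBasis, mkSl2, flipSign] <;> ring

theorem flipAmb_mulL_sb (m : Amb) (i : Fin 3) :
    flipAmb (mulL (sbBasis i) m) = flipSign i • mulR (sbBasis i) (flipAmb m) := by
  funext k l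
  fin_cases i <;> fin_cases k <;> fin_cases l <;>
    simp [flipAmb_entry, mulR_entry, mulL_entry, sbBasis, mkSl2, flipSign] <;> ring

theorem leftDer_flipD {φ : D → ℝ} (hφ : SmoothD φ) (g : D) {X : sl2} {c : ℝ}
    (hX : flipAmb (mulR X (amb g)) = c • mulL X (flipAmb (amb g))) :
    leftDer (fun p => φ (flipD p)) g X = c * rightDer φ (flipD g) X := by
  obtain ⟨F, hF, h⟩ := hφ (flipD g)
  replace hF : DifferentiableAt ℝ F (amb (flipD g)) := hF.differentiableAt (by simp)
  have hc : HasFDerivAt (fun m => F (flipAmb m)) _ (amb g) :=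
    HasFDerivAt.comp (amb g) (flipAmb_amb g ▸ hF.hasFDerivAt) flipAmb.hasFDerivAt
  rw [rightDer_eq hF h, leftDer_eq (F := fun m => F (flipAmb m)) hc.differentiableAt
    (continuous_flipD.continuousAt.eventually h), hc.fderiv, ContinuousLinearMap.comp_apply, hX,
    map_smul, flipAmb_amb, smul_eq_mul]

theorem rightDer_flipD {φ : D → ℝ} (hφ : SmoothD φ) (g : D) {X : sl2} {c : ℝ}
    (hX : flipAmb (mulL X (amb g)) = c • mulR X (flipAmb (amb g))) :
    rightDer (fun p => φ (flipD p)) g X = c * leftDer φ (flipD g) X := by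
  obtain ⟨F, hF, h⟩ := hφ (flipD g)
  replace hF : DifferentiableAt ℝ F (amb (flipD g)) := hF.differentiableAt (by simp)
  have hc : HasFDerivAt (fun m => F (flipAmb m)) _ (amb g) :=
    HasFDerivAt.comp (amb g) (flipAmb_amb g ▸ hF.hasFDerivAt) flipAmb.hasFDerivAt
  rw [leftDer_eq hF h, rightDer_eq (F := fun m => F (flipAmb m)) hc.differentiableAt
    (continuous_flipD.continuousAt.eventually h), hc.fderiv, ContinuousLinearMap.comp_apply, hX,
    map_smul, flipAmb_amb, smul_eq_mul]

/-- An anti-automorphism interchanges r^L and r^R. Dual basis vectors acquire the same sign, which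
enters each term squared. -/
theorem bracketD_flipD {φ ψ : D → ℝ} (hφ : SmoothD φ) (hψ : SmoothD ψ) (g : D) :
    bracketD (fun p => φ (flipD p)) (fun p => ψ (flipD p)) g = bracketD φ ψ (flipD g) := by
  have hs : ∀ i, flipSign i * flipSign i = 1 := fun i => by fin_cases i <;> simp [flipSign]
  simp only [bracketD]
  refine congrArg _ (Finset.sum_congr rfl fun i _ => ?_)
  rw [leftDer_flipD hφ g (flipAmb_mulR_su (amb g) i), leftDer_flipD hψ g (flipAmb_mulR_su _ i),
    leftDer_flipD hφ g (flipAmb_mulR_sb _ i), leftDer_flipD hψ g (flipAmb_mulR_sb _ i),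
    rightDer_flipD hφ g (flipAmb_mulL_su _ i), rightDer_flipD hψ g (flipAmb_mulL_su _ i),
    rightDer_flipD hφ g (flipAmb_mulL_sb _ i), rightDer_flipD hψ g (flipAmb_mulL_sb _ i)]
  linear_combination (rightDer φ (flipD g) (sbBasis i) * rightDer ψ (flipD g) (suBasis i)
    - rightDer φ (flipD g) (suBasis i) * rightDer ψ (flipD g) (sbBasis i)
    + (leftDer φ (flipD g) (sbBasis i) * leftDer ψ (flipD g) (suBasis i)
    - leftDer φ (flipD g) (suBasis i) * leftDer ψ (flipD g) (sbBasis i))) * hs i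

/-- The involution `z ↦ -z` of the coordinate space, as a linear map. -/
def flipCoords : (Fin 3 → ℝ) →L[ℝ] (Fin 3 → ℝ) :=
  ContinuousLinearMap.pi fun i => flipSign i • ContinuousLinearMap.proj i

theorem flipCoords_apply (v : Fin 3 → ℝ) : flipCoords v = ![v 0, v 1, -v 2] := by
  funext i
  fin_cases i <;> simp [flipCoords, flipSign]

/-- The anti-automorphism of `SB(2,ℂ)` exchanging the diagonal entries. -/
def flipSB (b : SB) : SB := ofCoords (flipCoords (coords b))

theorem coords_flipSB (b : SB) : coords (flipSB b) = flipCoords (coords b) := coords_ofCoords _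

theorem flipSB_ofCoords (v : Fin 3 → ℝ) : flipSB (ofCoords v) = ofCoords (flipCoords v) := by
  rw [flipSB, coords_ofCoords]

theorem flipSB_flipSB (b : SB) : flipSB (flipSB b) = b := by
  conv_rhs => rw [← ofCoords_coords b]
  rw [flipSB, coords_flipSB]
  refine congrArg ofCoords (funext fun i => ?_)
  fin_cases i <;> simp [flipCoords_apply]

/-- The flip reverses the factors of g = ub and preserves both subgroups; the verification compares
the explicit formulas. -/
theorem rightProj_eq_flip (g : D) : rightProj g = flipSB (leftProj (flipD g)) := by
  rw [leftProj_eq, flipSB_ofCoords, flipCoords_apply]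
  have h0 : rowNorm (amb (flipD g)) = Complex.normSq (g 0 0) + Complex.normSq (g 1 0) :=
    add_comm _ _
  have h1 : rowCross (amb (flipD g)) = star (g 0 0) * g 0 1 + star (g 1 0) * g 1 1 := by
    change g 1 1 * star (g 1 0) + g 0 1 * star (g 0 0) = _
    ring
  have hnn : 0 ≤ rowNorm (amb (flipD g)) := (rowNorm_pos _).le
  simp only [rightProj, projCoords, ← h0, ← h1, Complex.div_ofReal_re, Complex.div_ofReal_im,
    Real.log_sqrt hnn]
  refine congrArg ofCoords (funext fun i => ?_)
  fin_cases i
  · rfl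
  · rfl
  · change -2 * (Real.log (rowNorm (amb (flipD g))) / 2) = -Real.log (rowNorm (amb (flipD g)))
    ring

theorem SmoothSB.comp_flipSB {f : SB → ℝ} (hf : SmoothSB f) :
    SmoothSB fun b => f (flipSB b) := by
  have h : (fun v => f (flipSB (ofCoords v))) = fun v => f (ofCoords (flipCoords v)) :=
    funext fun v => by rw [flipSB_ofCoords]
  rw [SmoothSB, h]
  exact ContDiff.comp (g := fun v => f (ofCoords v)) hf flipCoords.contDiff

theorem diffSB_flipSB {f : SB → ℝ} (hf : SmoothSB f) (b : SB) :
    diffSB (fun b => f (flipSB b)) b = (diffSB f (flipSB b)).comp flipCoords := by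
  have h : (fun v => f (flipSB (ofCoords v))) = fun v => f (ofCoords (flipCoords v)) :=
    funext fun v => by rw [flipSB_ofCoords]
  rw [diffSB, diffSB, h, coords_flipSB]
  exact ((ContDiff.differentiable hf (by simp) _).hasFDerivAt.comp (coords b)
    flipCoords.hasFDerivAt).fderiv

/-- Under z ↦ -z the coefficient sinh z is odd, while the terms with coefficients x and y each
contain one z-derivative; so all three terms change sign. -/
theorem bracketSB_flipSB {f h : SB → ℝ} (hf : SmoothSB f) (hh : SmoothSB h) (b : SB) :
    bracketSB (fun b => f (flipSB b)) (fun b => h (flipSB b)) b = -bracketSB f h (flipSB b) := by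
  have p : ∀ {f : SB → ℝ}, SmoothSB f → ∀ i,
      partialSB i (fun b => f (flipSB b)) b = flipSign i * partialSB i f (flipSB b) := by
    intro f hf i
    rw [partialSB, partialSB, diffSB_flipSB hf, ContinuousLinearMap.comp_apply, ← smul_eq_mul,
      ← map_smul]
    congr 1
    funext j
    fin_cases i <;> fin_cases j <;> simp [flipCoords, flipSign]
  simp only [bracketSB, p hf, p hh, coords_flipSB, flipCoords_apply, flipSign]
  simp
  ring

theorem smoothD_rightProj {f : SB → ℝ} (hf : SmoothSB f) : SmoothD fun g => f (rightProj g) := by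
  simp only [rightProj_eq_flip]
  exact (smoothD_leftProj hf.comp_flipSB).comp_flipD

theorem bracketD_rightProj {f h : SB → ℝ} (hf : SmoothSB f) (hh : SmoothSB h) (g : D) :
    bracketD (fun p => f (rightProj p)) (fun p => h (rightProj p)) g =
      -bracketSB f h (rightProj g) := by
  simp only [rightProj_eq_flip]
  rw [bracketD_flipD (smoothD_leftProj hf.comp_flipSB) (smoothD_leftProj hh.comp_flipSB),
    bracketD_leftProj hf.comp_flipSB hh.comp_flipSB, bracketSB_flipSB hf hh]

theorem rightDer_rightProj_su {f : SB → ℝ} (hf : SmoothSB f) (g : D) (i : Fin 3) :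
    rightDer (fun p => f (rightProj p)) g (suBasis i) = 0 := by
  simp only [rightProj_eq_flip]
  rw [rightDer_flipD (smoothD_leftProj hf.comp_flipSB) g (flipAmb_mulL_su _ i),
    leftDer_leftProj_su hf.comp_flipSB, mul_zero]

/-- The differential of `f` at `π₂(g)` is determined by that of `f ∘ π₂` at `g`. -/
theorem diffSB_eq_zero_of_leftDer {f : SB → ℝ} (hf : SmoothSB f) (g : D)
    (h : ∀ i, leftDer (fun p => f (rightProj p)) g (sbBasis i) = 0) :
    diffSB f (rightProj g) = 0 := by
  have hf' := hf.comp_flipSB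
  have h1 : diffSB (fun b => f (flipSB b)) (leftProj (flipD g)) = 0 := by
    refine diffSB_eq_zero_of_rightDer hf' _ fun i => ?_
    have h2 := h i
    simp only [rightProj_eq_flip] at h2
    rw [leftDer_flipD (smoothD_leftProj hf') g (flipAmb_mulR_sb _ i)] at h2
    refine (mul_eq_zero.1 h2).resolve_left ?_
    fin_cases i <;> simp [flipSign]
  have h3 := diffSB_flipSB hf' (flipSB (leftProj (flipD g)))
  simp only [flipSB_flipSB] at h3
  rw [rightProj_eq_flip, h3, h1, ContinuousLinearMap.zero_comp]

/-! ### The two projections Poisson-commute -/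

/-- If P is orthogonal to su(2), its expansion in dual bases has only one half, and the sum is the
full invariant pairing of the traceless parts of P and Q. -/
theorem sum_pairing_of_su (P Q : Matrix (Fin 2) (Fin 2) ℂ)
    (h : ∀ i, (Matrix.trace (P * (suBasis i : Matrix (Fin 2) (Fin 2) ℂ))).im = 0) :
    ∑ i, (2 * (Matrix.trace (P * (sbBasis i : Matrix (Fin 2) (Fin 2) ℂ))).im)
        * (2 * (Matrix.trace (Q * (suBasis i : Matrix (Fin 2) (Fin 2) ℂ))).im) =
      2 * (Matrix.trace (P * Q)).im - (Matrix.trace P * Matrix.trace Q).im := by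
  have h0 := h 0
  have h1 := h 1
  have h2 := h 2
  simp [suBasis, mkSl2, Matrix.trace_fin_two, Matrix.mul_apply, Fin.sum_univ_two] at h0 h1 h2
  simp [Fin.sum_univ_three, suBasis, sbBasis, mkSl2, Matrix.trace_fin_two, Matrix.mul_apply,
    Fin.sum_univ_two]
  linear_combination -2 * (Q 1 0).im * h0 + 2 * (Q 1 0).re * h1
    - ((Q 0 0).im - (Q 1 1).im) * h2

/-- The differential of f ∘ π₁ kills su(2) in the left trivialisation, that of h ∘ π₂ in the right
one. So `sum_pairing_of_su` turns the r^L part into the pairing of Am with Bm and the r^R part into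
minus that of mB with mA; the pairings agree by cyclicity. -/
theorem bracketD_leftProj_rightProj {f h : SB → ℝ} (hf : SmoothSB f) (hh : SmoothSB h) (g : D) :
    bracketD (fun p => f (leftProj p)) (fun p => h (rightProj p)) g = 0 := by
  obtain ⟨F, hF, hfF⟩ := smoothD_leftProj hf g
  obtain ⟨H, hH, hhH⟩ := smoothD_rightProj hh g
  replace hF : DifferentiableAt ℝ F (amb g) := hF.differentiableAt (by simp)
  replace hH : DifferentiableAt ℝ H (amb g) := hH.differentiableAt (by simp)
  obtain ⟨A, hA⟩ := exists_trace_repr (fderiv ℝ F (amb g))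
  obtain ⟨B, hB⟩ := exists_trace_repr (fderiv ℝ H (amb g))
  set m : Matrix (Fin 2) (Fin 2) ℂ := (g : Matrix (Fin 2) (Fin 2) ℂ) with hm
  have lf : ∀ X : sl2, leftDer (fun p => f (leftProj p)) g X =
      2 * (Matrix.trace ((A * m) * (X : Matrix (Fin 2) (Fin 2) ℂ))).im := fun X => by
    rw [leftDer_eq hF hfF, mul_assoc]; exact hA _
  have lh : ∀ X : sl2, leftDer (fun p => h (rightProj p)) g X =
      2 * (Matrix.trace ((B * m) * (X : Matrix (Fin 2) (Fin 2) ℂ))).im := fun X => by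
    rw [leftDer_eq hH hhH, mul_assoc]; exact hB _
  have rf : ∀ X : sl2, rightDer (fun p => f (leftProj p)) g X =
      2 * (Matrix.trace ((m * A) * (X : Matrix (Fin 2) (Fin 2) ℂ))).im := fun X => by
    rw [rightDer_eq hF hfF, mul_assoc, Matrix.trace_mul_comm, mul_assoc]; exact hA _
  have rh : ∀ X : sl2, rightDer (fun p => h (rightProj p)) g X =
      2 * (Matrix.trace ((m * B) * (X : Matrix (Fin 2) (Fin 2) ℂ))).im := fun X => by
    rw [rightDer_eq hH hhH, mul_assoc, Matrix.trace_mul_comm, mul_assoc]; exact hB _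
  have e1 := sum_pairing_of_su (A * m) (B * m) fun i => by
    have := leftDer_leftProj_su hf g i
    rw [lf] at this
    linarith
  have e2 := sum_pairing_of_su (m * B) (m * A) fun i => by
    have := rightDer_rightProj_su hh g i
    rw [rh] at this
    linarith
  have t1 : Matrix.trace ((m * B) * (m * A)) = Matrix.trace ((A * m) * (B * m)) := by
    rw [Matrix.trace_mul_comm, mul_assoc, Matrix.trace_mul_comm, mul_assoc, mul_assoc, mul_assoc]
  rw [t1, Matrix.trace_mul_comm m B, Matrix.trace_mul_comm m A,
    mul_comm (Matrix.trace (B * m))] at e2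
  simp only [← lf, ← lh] at e1
  simp only [← rf, ← rh] at e2
  rw [← e2] at e1
  simp only [bracketD, leftDer_leftProj_su hf, rightDer_rightProj_su hh, mul_zero, zero_mul,
    sub_zero, zero_sub, Finset.sum_add_distrib, e1, Finset.sum_neg_distrib]
  rw [Finset.sum_congr rfl fun i _ => mul_comm _ _, add_neg_cancel, mul_zero]

/-! ### The Casimir function -/

theorem casimir_ofCoords (v : Fin 3 → ℝ) :
    casimir (ofCoords v) = v 0 ^ 2 + v 1 ^ 2 + 4 * Real.sinh (v 2 / 2) ^ 2 := by
  rw [casimir, coords_ofCoords]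

theorem smoothSB_casimir : SmoothSB casimir := by
  rw [SmoothSB, funext casimir_ofCoords]
  have h : ContDiff ℝ ∞ fun v : Fin 3 → ℝ => Real.sinh (v 2 / 2) :=
    Real.contDiff_sinh.comp ((contDiff_apply ℝ ℝ (2 : Fin 3)).div_const 2)
  fun_prop

theorem diffSB_casimir (b : SB) (v : Fin 3 → ℝ) : diffSB casimir b v =
    2 * (v 0 * coords b 0 + v 1 * coords b 1 + v 2 * Real.sinh (coords b 2)) := by
  have p : ∀ i : Fin 3, HasFDerivAt (fun v : Fin 3 → ℝ => v i)
      (ContinuousLinearMap.proj (R := ℝ) (φ := fun _ => ℝ) i) (coords b) :=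
    fun i => hasFDerivAt_apply i _
  have h := (((p 0).pow 2).add ((p 1).pow 2)).add
    ((((p 2).mul_const (1 / 2)).sinh.pow 2).const_mul 4)
  have h' : HasFDerivAt (fun v => casimir (ofCoords v)) _ (coords b) :=
    h.congr_of_eventuallyEq (Filter.Eventually.of_forall fun v => by
      change casimir (ofCoords v) = _
      rw [casimir_ofCoords]
      simp [div_eq_mul_inv])
  have hs : Real.sinh (coords b 2) =
      2 * Real.sinh (coords b 2 * 2⁻¹) * Real.cosh (coords b 2 * 2⁻¹) := by
    rw [← Real.sinh_two_mul]
    ring_nf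
  rw [diffSB, h'.fderiv, hs]
  simp
  ring

theorem partialSB_casimir (b : SB) : partialSB 0 casimir b = 2 * coords b 0 ∧
    partialSB 1 casimir b = 2 * coords b 1 ∧
    partialSB 2 casimir b = 2 * Real.sinh (coords b 2) := by
  simp [partialSB, diffSB_casimir]

theorem bracketSB_casimir (f : SB → ℝ) (b : SB) : bracketSB casimir f b = 0 := by
  obtain ⟨h0, h1, h2⟩ := partialSB_casimir b
  rw [bracketSB, h0, h1, h2]
  ring

theorem casimir_flipSB (b : SB) : casimir (flipSB b) = casimir b := by
  simp [casimir, coords_flipSB, flipCoords_apply, neg_div]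

/-- For g = bu one has gg* = bb*, whose trace is x² + y² + 2 cosh z = c + 2. -/
theorem casimir_leftProj (g : D) : casimir (leftProj g) =
    Complex.normSq (g 0 0) + Complex.normSq (g 0 1) + rowNorm (amb g) - 2 := by
  obtain ⟨s, x, y, hs0, hs2, hs, hv, hN⟩ := exists_polar g
  have hG := row_gram g
  have he : Real.log (s ^ 2) / 2 = Real.log s := by
    rw [Real.log_pow]
    push_cast
    ring
  rw [casimir, coords_leftProj, hv]
  simp only [Matrix.cons_val_zero, Matrix.cons_val_one, Matrix.cons_val, he]
  rw [Real.sinh_eq, Real.exp_neg, Real.exp_log hs0]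
  rw [hN, ← hs2] at hG
  rw [← hs2]
  field_simp
  simp only at hG
  linear_combination -4 * hG

theorem casimir_rightProj (g : D) : casimir (rightProj g) = casimir (leftProj g) := by
  rw [rightProj_eq_flip, casimir_flipSB, casimir_leftProj, casimir_leftProj]
  simp only [rowNorm, amb, flipD]
  simp
  ring

/-! ### Involution -/

theorem bracketD_eq_zero_symm {φ ψ : D → ℝ} {g : D} (h : bracketD φ ψ g = 0) :
    bracketD ψ φ g = 0 := by
  rw [bracketD_skew, h, neg_zero]

theorem bracketD_self (φ : D → ℝ) (g : D) : bracketD φ φ g = 0 :=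
  self_eq_neg.1 (bracketD_skew g)

theorem involution {f h : SB → ℝ} (hf : SmoothSB f) (hh : SmoothSB h) (i j : Fin 3) (g : D) :
    bracketD
      ((![fun p => casimir (leftProj p), fun p => f (leftProj p),
        fun p => h (rightProj p)] : Fin 3 → D → ℝ) i)
      ((![fun p => casimir (leftProj p), fun p => f (leftProj p),
        fun p => h (rightProj p)] : Fin 3 → D → ℝ) j) g = 0 := by
  have h1 : bracketD (fun p => casimir (leftProj p)) (fun p => f (leftProj p)) g = 0 := by
    rw [bracketD_leftProj smoothSB_casimir hf, bracketSB_casimir]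
  have h2 := bracketD_leftProj_rightProj smoothSB_casimir hh g
  have h3 := bracketD_leftProj_rightProj hf hh g
  fin_cases i <;> fin_cases j
  exacts [bracketD_self _ g, h1, h2, bracketD_eq_zero_symm h1, bracketD_self _ g, h3,
    bracketD_eq_zero_symm h2, bracketD_eq_zero_symm h3, bracketD_self _ g]

/-! ### Independence at a point -/

/-- The Hamiltonian vector field of `f` on `SB(2,ℂ)`, up to sign. -/
def hamSB (f : SB → ℝ) (b : SB) : Fin 3 → ℝ :=
  ![coords b 1 * partialSB 2 f b - Real.sinh (coords b 2) * partialSB 1 f b,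
    Real.sinh (coords b 2) * partialSB 0 f b - coords b 0 * partialSB 2 f b,
    coords b 0 * partialSB 1 f b - coords b 1 * partialSB 0 f b]

theorem hamSB_eq_zero_iff (f : SB → ℝ) (b : SB) : hamSB f b = 0 ↔
    coords b 1 * partialSB 2 f b - Real.sinh (coords b 2) * partialSB 1 f b = 0 ∧
    Real.sinh (coords b 2) * partialSB 0 f b - coords b 0 * partialSB 2 f b = 0 ∧
    coords b 0 * partialSB 1 f b - coords b 1 * partialSB 0 f b = 0 := by
  rw [funext_iff]
  simp [hamSB, Fin.forall_fin_succ]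

theorem bracketSB_eq_ham (f h : SB → ℝ) (b : SB) : bracketSB f h b =
    -(partialSB 0 f b * hamSB h b 0 + partialSB 1 f b * hamSB h b 1
      + partialSB 2 f b * hamSB h b 2) := by
  simp [bracketSB, hamSB]
  ring

theorem clm_eq_zero_iff (L : (Fin 3 → ℝ) →L[ℝ] ℝ) :
    L = 0 ↔ L (Pi.single 0 1) = 0 ∧ L (Pi.single 1 1) = 0 ∧ L (Pi.single 2 1) = 0 := by
  constructor
  · rintro rfl
    simp
  · rintro ⟨h0, h1, h2⟩
    ext v
    have h : v = ∑ i, v i • (Pi.single i 1 : Fin 3 → ℝ) := by simpa using pi_eq_sum_univ' v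
    rw [h, map_sum]
    simp [Fin.sum_univ_three, h0, h1, h2]

/-- In coordinates `hamSB f` is half the cross product of the gradients of c and f. -/
theorem linearIndependent_casimir_iff (f : SB → ℝ) (b : SB) :
    LinearIndependent ℝ (fun i => diffSB ((![casimir, f] : Fin 2 → SB → ℝ) i) b) ↔
      hamSB f b ≠ 0 := by
  have hv : (fun i => diffSB ((![casimir, f] : Fin 2 → SB → ℝ) i) b) =
      ![diffSB casimir b, diffSB f b] := by
    funext i
    fin_cases i <;> rfl
  obtain ⟨c0, c1, c2⟩ := partialSB_casimir b
  have comb : ∀ s t : ℝ, s • diffSB casimir b + t • diffSB f b = 0 ↔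
      s * (2 * coords b 0) + t * partialSB 0 f b = 0 ∧
      s * (2 * coords b 1) + t * partialSB 1 f b = 0 ∧
      s * (2 * Real.sinh (coords b 2)) + t * partialSB 2 f b = 0 := fun s t => by
    rw [clm_eq_zero_iff, ← c0, ← c1, ← c2]
    rfl
  rw [hv, LinearIndependent.pair_iff, Ne, hamSB_eq_zero_iff]
  simp only [comb]
  constructor
  · rintro h ⟨h0, h1, h2⟩
    -- A zero cross product makes ∂ᵢf·dc - ∂ᵢc·df vanish for each i. Independence then forces every
    -- ∂ᵢc to be zero, so dc = 0, a contradiction.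
    have e0 := (h (partialSB 0 f b) (-(2 * coords b 0))
      ⟨by ring, by linear_combination -2 * h2, by linear_combination 2 * h1⟩).2
    have e1 := (h (partialSB 1 f b) (-(2 * coords b 1))
      ⟨by linear_combination 2 * h2, by ring, by linear_combination -2 * h0⟩).2
    have e2 := (h (partialSB 2 f b) (-(2 * Real.sinh (coords b 2)))
      ⟨by linear_combination -2 * h1, by linear_combination 2 * h0, by ring⟩).2
    have := (h 1 0 ⟨by linarith, by linarith, by linarith⟩).1
    exact one_ne_zero this
  · intro h s t ⟨h0, h1, h2⟩
    have ht : t = 0 := by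
      by_contra ht
      refine h ⟨mul_left_cancel₀ ht ?_, mul_left_cancel₀ ht ?_, mul_left_cancel₀ ht ?_⟩
      · linear_combination coords b 1 * h2 - Real.sinh (coords b 2) * h1
      · linear_combination Real.sinh (coords b 2) * h0 - coords b 0 * h2
      · linear_combination coords b 0 * h1 - coords b 1 * h0
    subst ht
    refine ⟨?_, rfl⟩
    by_contra hs
    have e0 : coords b 0 = 0 := mul_left_cancel₀ hs (by linarith)
    have e1 : coords b 1 = 0 := mul_left_cancel₀ hs (by linarith)
    have e2 : Real.sinh (coords b 2) = 0 := mul_left_cancel₀ hs (by linarith)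
    exact h (by simp [e0, e1, e2])

theorem leftDer_rightProj {f : SB → ℝ} (hf : SmoothSB f) (g : D) (X : sl2) :
    leftDer (fun p => f (rightProj p)) g X = diffSB f (rightProj g)
      (flipCoords (fderiv ℝ projCoords (amb (flipD g)) (flipAmb (mulR X (amb g))))) := by
  have hf' := hf.comp_flipSB
  have h1 := ((contDiffAt_pullback hf' (flipD g)).differentiableAt (by simp)).hasFDerivAt
  have hc : HasFDerivAt (fun m => f (flipSB (ofCoords (projCoords (flipAmb m))))) _ (amb g) :=
    HasFDerivAt.comp (g := fun m => f (flipSB (ofCoords (projCoords m)))) (amb g)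
      (flipAmb_amb g ▸ h1) flipAmb.hasFDerivAt
  have he : ∀ᶠ p in 𝓝 g, f (rightProj p) = f (flipSB (ofCoords (projCoords (flipAmb (amb p))))) :=
    Filter.Eventually.of_forall fun p => by rw [rightProj_eq_flip, leftProj_eq, flipAmb_amb]
  rw [leftDer_eq hc.differentiableAt he, hc.fderiv, ContinuousLinearMap.comp_apply,
    flipAmb_amb, fderiv_pullback hf', diffSB_flipSB hf, ← rightProj_eq_flip,
    ContinuousLinearMap.comp_apply]

theorem rightDer_eq_leftDer (g : D) (X : sl2) : ∃ X' : sl2, ∀ φ, SmoothD φ →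
    rightDer φ g X = leftDer φ g X' := by
  have h : ((g : Matrix (Fin 2) (Fin 2) ℂ)) * ((g⁻¹ : D) : Matrix (Fin 2) (Fin 2) ℂ) = 1 := by
    rw [← Matrix.SpecialLinearGroup.coe_mul, mul_inv_cancel, Matrix.SpecialLinearGroup.coe_one]
  refine ⟨⟨((g⁻¹ : D) : Matrix (Fin 2) (Fin 2) ℂ) * X * g, LinearMap.mem_ker.2 ?_⟩,
    fun φ hφ => ?_⟩
  · rw [Matrix.traceLinearMap_apply, Matrix.trace_mul_comm, ← mul_assoc, h, one_mul, trace_sl2]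
  · obtain ⟨F, hF, hφF⟩ := hφ g
    replace hF := hF.differentiableAt (by simp)
    rw [rightDer_eq hF hφF, leftDer_eq hF hφF]
    congr 1
    change (X : Matrix (Fin 2) (Fin 2) ℂ) * (g : Matrix (Fin 2) (Fin 2) ℂ) =
      (g : Matrix (Fin 2) (Fin 2) ℂ) * (((g⁻¹ : D) : Matrix (Fin 2) (Fin 2) ℂ) * X * g)
    rw [← mul_assoc, ← mul_assoc, h, one_mul]

/-- The right derivatives are determined by the left ones, because Xg = g(g⁻¹Xg). -/
theorem bracketD_congr {φ χ : D → ℝ} (hφ : SmoothD φ) (hχ : SmoothD χ) {g : D}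
    (h : ∀ X, leftDer φ g X = leftDer χ g X) (ψ : D → ℝ) :
    bracketD φ ψ g = bracketD χ ψ g := by
  have h' : ∀ X, rightDer φ g X = rightDer χ g X := fun X => by
    obtain ⟨X', hX'⟩ := rightDer_eq_leftDer g X
    rw [hX' φ hφ, hX' χ hχ, h]
  simp only [bracketD, h, h']

theorem smoothSB_coords (i : Fin 3) : SmoothSB fun b => coords b i := by
  have h : (fun v => coords (ofCoords v) i) = fun v => v i := funext fun v => by
    rw [coords_ofCoords]
  rw [SmoothSB, h]
  exact contDiff_apply ℝ ℝ i

theorem diffSB_coords (i : Fin 3) (b : SB) (v : Fin 3 → ℝ) :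
    diffSB (fun b => coords b i) b v = v i := by
  have h : (fun v => coords (ofCoords v) i) = fun v => v i := funext fun v => by
    rw [coords_ofCoords]
  rw [diffSB, h, (hasFDerivAt_apply i _).fderiv]
  rfl

theorem smoothSB_comb {f h : SB → ℝ} (hf : SmoothSB f) (hh : SmoothSB h) (s t : ℝ) :
    SmoothSB fun b => s * f b + t * h b :=
  (contDiff_const.mul hf).add (contDiff_const.mul hh)

theorem diffSB_comb {f h : SB → ℝ} (hf : SmoothSB f) (hh : SmoothSB h) (s t : ℝ) (b : SB) :
    diffSB (fun b => s * f b + t * h b) b = s • diffSB f b + t • diffSB h b :=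
  (((ContDiff.differentiable hf (by simp) _).hasFDerivAt.const_mul s).add
    ((ContDiff.differentiable hh (by simp) _).hasFDerivAt.const_mul t)).fderiv

theorem partialSB_comb {f h : SB → ℝ} (hf : SmoothSB f) (hh : SmoothSB h) (s t : ℝ) (i : Fin 3)
    (b : SB) : partialSB i (fun b => s * f b + t * h b) b =
      s * partialSB i f b + t * partialSB i h b := by
  rw [partialSB, diffSB_comb hf hh]
  rfl

/-- A covector at `g` that is pulled back along both projections annihilates the
Hamiltonian vectors. -/
theorem hamSB_eq_zero_of_leftDer_eq {f h : SB → ℝ} (hf : SmoothSB f) (hh : SmoothSB h) {g : D}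
    (e : ∀ X, leftDer (fun p => f (leftProj p)) g X = leftDer (fun p => h (rightProj p)) g X) :
    hamSB f (leftProj g) = 0 := by
  have key : ∀ i, bracketSB f (fun b => coords b i) (leftProj g) = 0 := fun i => by
    rw [← bracketD_leftProj hf (smoothSB_coords i),
      bracketD_congr (smoothD_leftProj hf) (smoothD_rightProj hh) e]
    exact bracketD_eq_zero_symm (bracketD_leftProj_rightProj (smoothSB_coords i) hh g)
  have k0 := key 0
  have k1 := key 1
  have k2 := key 2
  simp [bracketSB, partialSB, diffSB_coords] at k0 k1 k2
  rw [hamSB_eq_zero_iff]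
  simp only [partialSB]
  exact ⟨by linear_combination k0, by linear_combination k1, by linear_combination k2⟩

/-- The identity c ∘ π₁ = c ∘ π₂ lets c be read on either side, so each pair must be independent
downstairs. Conversely the common covectors of the two projections are under control by
`hamSB_eq_zero_of_leftDer_eq`. -/
theorem linearIndependent_pullback_iff {f h : SB → ℝ} (hf : SmoothSB f) (hh : SmoothSB h)
    (g : D) :
    LinearIndependent ℝ (fun i => leftDer ((![fun p => casimir (leftProj p),
      fun p => f (leftProj p), fun p => h (rightProj p)] : Fin 3 → D → ℝ) i) g) ↔
      hamSB f (leftProj g) ≠ 0 ∧ hamSB h (rightProj g) ≠ 0 := by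
  have hC := smoothSB_casimir
  have hc : ∀ X, leftDer (fun p => casimir (leftProj p)) g X =
      leftDer (fun p => casimir (rightProj p)) g X := fun X => by simp only [casimir_rightProj]
  rw [Fintype.linearIndependent_iff]
  simp only [Fin.sum_univ_three]
  constructor
  · intro H
    rw [← linearIndependent_casimir_iff, ← linearIndependent_casimir_iff,
      Fintype.linearIndependent_iff, Fintype.linearIndependent_iff]
    simp only [Fin.sum_univ_two]
    constructor
    · intro a ha
      have := H ![a 0, a 1, 0] (funext fun X => by
        have := congrArg (fun L => L (fderiv ℝ projCoords (amb g) (mulR X (amb g)))) ha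
        simpa [leftDer_leftProj hC, leftDer_leftProj hf] using this)
      intro i
      fin_cases i
      · exact this 0
      · exact this 1
    · intro a ha
      have := H ![a 0, 0, a 1] (funext fun X => by
        have := congrArg (fun L => L (flipCoords (fderiv ℝ projCoords (amb (flipD g))
          (flipAmb (mulR X (amb g)))))) ha
        simpa [hc, leftDer_rightProj hC, leftDer_rightProj hh] using this)
      intro i
      fin_cases i
      · exact this 0
      · exact this 2
  · rintro ⟨H1, H2⟩ a ha
    have hX : ∀ X, a 0 * leftDer (fun p => casimir (leftProj p)) g X
        + a 1 * leftDer (fun p => f (leftProj p)) g X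
        + a 2 * leftDer (fun p => h (rightProj p)) g X = 0 := fun X => congrFun ha X
    -- The relation equates the pullback of a₀c + a₁f along π₁ with that of -a₂h along π₂. Since c
    -- has no Hamiltonian vector, a₁ times that of f is zero, whence a₁ = 0.
    have hk := hamSB_eq_zero_of_leftDer_eq (smoothSB_comb hC hf (a 0) (a 1))
      (smoothSB_comb hh hh (-a 2) 0) (g := g) fun X => by
        rw [leftDer_leftProj (smoothSB_comb hC hf _ _), leftDer_rightProj (smoothSB_comb hh hh _ _),
          diffSB_comb hC hf, diffSB_comb hh hh]
        have := hX X
        rw [leftDer_leftProj hC, leftDer_leftProj hf, leftDer_rightProj hh] at this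
        simp
        linear_combination this
    obtain ⟨c0, c1, c2⟩ := partialSB_casimir (leftProj g)
    simp only [hamSB_eq_zero_iff, partialSB_comb hC hf, c0, c1, c2] at hk
    obtain ⟨k0, k1, k2⟩ := hk
    have ha1 : a 1 = 0 := by
      by_contra ha1
      refine H1 ((hamSB_eq_zero_iff _ _).2
        ⟨mul_left_cancel₀ ha1 ?_, mul_left_cancel₀ ha1 ?_, mul_left_cancel₀ ha1 ?_⟩)
      · linear_combination k0
      · linear_combination k1
      · linear_combination k2
    -- With a₁ = 0 and c moved to π₂, the whole relation is a pullback along the submersion π₂ and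
    -- descends to `SB`.
    have hd := diffSB_eq_zero_of_leftDer (smoothSB_comb hC hh (a 0) (a 2)) g fun i => by
      rw [leftDer_rightProj (smoothSB_comb hC hh _ _), diffSB_comb hC hh]
      have := hX (sbBasis i)
      rw [ha1, hc, leftDer_rightProj hC, leftDer_rightProj hh] at this
      simp
      linear_combination this
    rw [diffSB_comb hC hh] at hd
    rw [← linearIndependent_casimir_iff, Fintype.linearIndependent_iff] at H2
    have h02 := H2 ![a 0, a 2] (by rw [Fin.sum_univ_two]; exact hd)
    intro i
    fin_cases i
    exacts [h02 0, ha1, h02 1]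

/-! ### Topology of the projections -/

theorem continuous_ofCoords : Continuous ofCoords := by
  refine Continuous.subtype_mk (Continuous.subtype_mk (continuous_matrix fun i j => ?_) _) _
  fin_cases i <;> fin_cases j
  · change Continuous fun v : Fin 3 → ℝ => ((Real.exp (-(v 2) / 2) : ℝ) : ℂ)
    fun_prop
  · change Continuous fun v : Fin 3 → ℝ => (v 0 : ℂ) + (v 1 : ℂ) * Complex.I
    fun_prop
  · exact continuous_const
  · change Continuous fun v : Fin 3 → ℝ => ((Real.exp (v 2 / 2) : ℝ) : ℂ)
    fun_prop

theorem continuous_coords : Continuous coords := by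
  have h : ∀ i j, Continuous fun b : SB => (b : D) i j := fun i j =>
    (continuous_apply_apply i j).comp (continuous_amb.comp continuous_subtype_val)
  refine continuous_pi fun i => ?_
  fin_cases i
  · exact Complex.continuous_re.comp (h 0 1)
  · exact Complex.continuous_im.comp (h 0 1)
  · exact continuous_const.mul ((Complex.continuous_re.comp (h 0 0)).log fun b => b.2.2.1.ne')

/-- The global chart of `SB(2,ℂ)`. -/
def coordsHomeo : SB ≃ₜ (Fin 3 → ℝ) where
  toFun := coords
  invFun := ofCoords
  left_inv := ofCoords_coords
  right_inv := coords_ofCoords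
  continuous_toFun := continuous_coords
  continuous_invFun := continuous_ofCoords

theorem continuous_leftProj : Continuous leftProj := by
  rw [funext leftProj_eq]
  refine continuous_ofCoords.comp (continuous_iff_continuousAt.2 fun g => ?_)
  exact (contDiffAt_projCoords (rowNorm_pos g)).continuousAt.comp continuous_amb.continuousAt

theorem continuous_rightProj : Continuous rightProj := by
  rw [funext rightProj_eq_flip]
  exact (continuous_ofCoords.comp (flipCoords.continuous.comp continuous_coords)).comp
    (continuous_leftProj.comp continuous_flipD)

/-- Through g = b₁u passes the continuous section b ↦ bu. -/
theorem isOpenMap_leftProj : IsOpenMap leftProj := by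
  refine IsOpenMap.of_sections fun g =>
    ⟨fun b => (b : D) * ((leftProj g : D)⁻¹ * g), ?_, mul_inv_cancel_left _ _, fun b => ?_⟩
  · exact (continuous_subtype_val.mul continuous_const).continuousAt
  · rw [leftProj_eq_iff, inv_mul_cancel_left]
    exact leftProj_spec g

theorem isOpenMap_rightProj : IsOpenMap rightProj := by
  refine IsOpenMap.of_sections fun g =>
    ⟨fun b => (g * (rightProj g : D)⁻¹) * (b : D), ?_, inv_mul_cancel_right _ _, fun b => ?_⟩
  · exact (continuous_const.mul continuous_subtype_val).continuousAt
  · rw [rightProj_eq_iff, mul_inv_cancel_right]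
    exact rightProj_spec g

theorem leftProj_coe (b : SB) : leftProj (b : D) = b := by
  rw [leftProj_eq_iff, inv_mul_cancel]
  exact SU.one_mem

theorem rightProj_coe (b : SB) : rightProj (b : D) = b := by
  rw [rightProj_eq_iff, mul_inv_cancel]
  exact SU.one_mem

theorem dense_preimage_leftProj_iff {s : Set SB} : Dense (leftProj ⁻¹' s) ↔ Dense s := by
  have hs : Function.Surjective leftProj := fun b => ⟨b, leftProj_coe b⟩
  refine ⟨fun h => ?_, fun h => h.preimage isOpenMap_leftProj⟩
  simpa [Set.image_preimage_eq s hs] using hs.denseRange.dense_image continuous_leftProj h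

theorem dense_preimage_rightProj_iff {s : Set SB} : Dense (rightProj ⁻¹' s) ↔ Dense s := by
  have hs : Function.Surjective rightProj := fun b => ⟨b, rightProj_coe b⟩
  refine ⟨fun h => ?_, fun h => h.preimage isOpenMap_rightProj⟩
  simpa [Set.image_preimage_eq s hs] using hs.denseRange.dense_image continuous_rightProj h

/-! ### Generic independence -/

theorem continuous_partialSB {f : SB → ℝ} (hf : SmoothSB f) (i : Fin 3) :
    Continuous (partialSB i f) := by
  have h : Continuous (fderiv ℝ fun v => f (ofCoords v)) := ContDiff.continuous_fderiv hf (by simp)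
  exact (h.comp continuous_coords).clm_apply continuous_const

theorem isOpen_hamSB_ne_zero {f : SB → ℝ} (hf : SmoothSB f) : IsOpen {b | hamSB f b ≠ 0} := by
  have hc : ∀ i, Continuous fun b => coords b i := fun i =>
    (continuous_apply i).comp continuous_coords
  have hs := Real.continuous_sinh.comp (hc 2)
  have hp := continuous_partialSB hf
  have h : Continuous (hamSB f) := by
    refine continuous_pi fun i => ?_
    fin_cases i
    · exact ((hc 1).mul (hp 2)).sub (hs.mul (hp 1))
    · exact (hs.mul (hp 0)).sub ((hc 0).mul (hp 2))
    · exact ((hc 0).mul (hp 1)).sub ((hc 1).mul (hp 0))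
  exact isOpen_ne.preimage h

theorem genIndepSB_casimir_iff {f : SB → ℝ} (hf : SmoothSB f) :
    GenIndepSB ![casimir, f] ↔ Dense {b | hamSB f b ≠ 0} := by
  constructor
  · rintro ⟨U, _, hd, hU⟩
    exact hd.mono fun b hb => (linearIndependent_casimir_iff f b).1 (hU b hb)
  · exact fun h => ⟨_, isOpen_hamSB_ne_zero hf, h, fun b hb =>
      (linearIndependent_casimir_iff f b).2 hb⟩

theorem genIndepD_iff {f h : SB → ℝ} (hf : SmoothSB f) (hh : SmoothSB h) :
    GenIndepD ![fun p => casimir (leftProj p), fun p => f (leftProj p),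
        fun p => h (rightProj p)] ↔
      GenIndepSB ![casimir, f] ∧ GenIndepSB ![casimir, h] := by
  rw [genIndepSB_casimir_iff hf, genIndepSB_casimir_iff hh, ← dense_preimage_leftProj_iff,
    ← dense_preimage_rightProj_iff]
  have key := linearIndependent_pullback_iff hf hh
  constructor
  · rintro ⟨U, _, hd, hU⟩
    exact ⟨hd.mono fun g hg => ((key g).1 (hU g hg)).1, hd.mono fun g hg =>
      ((key g).1 (hU g hg)).2⟩
  · rintro ⟨h1, h2⟩
    have o1 := (isOpen_hamSB_ne_zero hf).preimage continuous_leftProj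
    have o2 := (isOpen_hamSB_ne_zero hh).preimage continuous_rightProj
    exact ⟨_, o1.inter o2, h1.inter_of_isOpen_left h2 o1, fun g hg => (key g).2 hg⟩

/-! ### Generic linear perturbations -/

open MeasureTheory in
theorem volume_affine_eq_zero {L : (Fin 3 → ℝ) →ₗ[ℝ] (Fin 3 → ℝ)} (hL : L ≠ 0) (u : Fin 3 → ℝ) :
    volume {a | u + L a = 0} = 0 := by
  rcases Set.eq_empty_or_nonempty {a | u + L a = 0} with h | ⟨a₀, h₀⟩
  · rw [h, measure_empty]
  · refine measure_mono_null (t := (AffineSubspace.mk' a₀ (LinearMap.ker L) : Set (Fin 3 → ℝ)))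
      (fun a ha => ?_) (Measure.addHaar_affineSubspace _ _ fun htop => hL ?_)
    · rw [SetLike.mem_coe, AffineSubspace.mem_mk', LinearMap.mem_ker, vsub_eq_sub, map_sub]
      have h1 : u + L a = u + L a₀ := Eq.trans ha (Eq.symm h₀)
      exact sub_eq_zero.2 (add_left_cancel h1)
    · have h1 := congrArg AffineSubspace.direction htop
      rw [AffineSubspace.direction_mk', AffineSubspace.direction_top] at h1
      exact LinearMap.ker_eq_top.1 h1

/-- The perturbation of `f` by a linear function of the coordinates with a cutoff. -/
def perturb (f : SB → ℝ) (σ : (Fin 3 → ℝ) → ℝ) (a : Fin 3 → ℝ) (b : SB) : ℝ :=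
  f b + σ (coords b) * ∑ i, a i * coords b i

theorem hasFDerivAt_perturb {f : SB → ℝ} (hf : SmoothSB f) {σ : (Fin 3 → ℝ) → ℝ}
    (hσ : ContDiff ℝ ∞ σ) (a : Fin 3 → ℝ) :
    SmoothSB (perturb f σ a) ∧ ∀ i b, partialSB i (perturb f σ a) b = partialSB i f b
      + (σ (coords b) * a i
        + fderiv ℝ σ (coords b) (Pi.single i 1) * ∑ j, a j * coords b j) := by
  have e : (fun v => perturb f σ a (ofCoords v)) =
      fun v => f (ofCoords v) + σ v * ∑ i, a i * v i := funext fun v => by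
    rw [perturb, coords_ofCoords]
  have hl : ContDiff ℝ ∞ fun v : Fin 3 → ℝ => ∑ i, a i * v i := by fun_prop
  have hl' : ∀ v : Fin 3 → ℝ, HasFDerivAt (fun v : Fin 3 → ℝ => ∑ i, a i * v i)
      (∑ i, a i • ContinuousLinearMap.proj (R := ℝ) (φ := fun _ => ℝ) i) v := fun v =>
    HasFDerivAt.fun_sum fun i _ => (hasFDerivAt_apply i v).const_mul (a i)
  constructor
  · rw [SmoothSB, e]
    exact ContDiff.add hf (hσ.mul hl)
  · intro i b
    have h1 := (ContDiff.differentiable hf (by simp) (coords b)).hasFDerivAt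
    have h2 := (hσ.differentiable (by simp) (coords b)).hasFDerivAt
    have h3 : HasFDerivAt (fun v => f (ofCoords v) + σ v * ∑ i, a i * v i) _ (coords b) :=
      h1.add (h2.mul (hl' (coords b)))
    rw [partialSB, diffSB, e, h3.fderiv]
    simp [partialSB, diffSB, Pi.single_apply]
    ring

theorem hamSB_perturb {f : SB → ℝ} (hf : SmoothSB f) {σ : (Fin 3 → ℝ) → ℝ}
    (hσ : ContDiff ℝ ∞ σ) {b : SB} (hb : coords b ≠ 0) (hσb : σ (coords b) ≠ 0) :
    ∃ L : (Fin 3 → ℝ) →ₗ[ℝ] (Fin 3 → ℝ), L ≠ 0 ∧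
      ∀ a, hamSB (perturb f σ a) b = hamSB f b + L a := by
  set v := coords b with hv
  set c := σ v
  set S := Real.sinh (v 2) with hS
  set d : Fin 3 → ℝ := fun i => fderiv ℝ σ v (Pi.single i 1)
  let L : (Fin 3 → ℝ) →ₗ[ℝ] (Fin 3 → ℝ) :=
    { toFun := fun a =>
        ![v 1 * (c * a 2 + d 2 * ∑ j, a j * v j) - S * (c * a 1 + d 1 * ∑ j, a j * v j),
          S * (c * a 0 + d 0 * ∑ j, a j * v j) - v 0 * (c * a 2 + d 2 * ∑ j, a j * v j),
          v 0 * (c * a 1 + d 1 * ∑ j, a j * v j) - v 1 * (c * a 0 + d 0 * ∑ j, a j * v j)]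
      map_add' := by
        intro a a'
        funext i
        fin_cases i <;> simp [Fin.sum_univ_three] <;> ring
      map_smul' := by
        intro t a
        funext i
        fin_cases i <;> simp [Fin.sum_univ_three] <;> ring }
  refine ⟨L, fun h0 => ?_, fun a => ?_⟩
  -- The test vectors are orthogonal to v, so the terms with derivatives of the cutoff drop out. The
  -- results are sums of nonnegative terms, since sinh t and t have the same sign.
  · have e0 := congrFun (LinearMap.congr_fun h0 ![0, v 2, -v 1]) 0
    have e1 := congrFun (LinearMap.congr_fun h0 ![-v 2, 0, v 0]) 1
    have e2 := congrFun (LinearMap.congr_fun h0 ![v 1, -v 0, 0]) 2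
    simp [L, Fin.sum_univ_three] at e0 e1 e2
    have f0 : v 1 * v 1 + S * v 2 = 0 := mul_left_cancel₀ hσb (by linear_combination -e0)
    have f1 : v 0 * v 0 + S * v 2 = 0 := mul_left_cancel₀ hσb (by linear_combination -e1)
    have f2 : v 0 * v 0 + v 1 * v 1 = 0 := mul_left_cancel₀ hσb (by linear_combination -e2)
    have g0 : v 0 = 0 := by nlinarith
    have g1 : v 1 = 0 := by nlinarith
    have g2 : v 2 = 0 := by
      rw [g1, zero_mul, zero_add] at f0
      rcases mul_eq_zero.1 f0 with h | h
      · exact Real.sinh_eq_zero.1 h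
      · exact h
    exact hb (funext fun i => by fin_cases i <;> assumption)
  · have p := (hasFDerivAt_perturb hf hσ a).2
    funext i
    fin_cases i <;> simp [hamSB, p, L, ← hv, ← hS, c, d] <;> ring

open MeasureTheory in
/-- For almost every linear perturbation of `f`, the Hamiltonian vector field is nonzero on a dense
subset of the support of the cutoff. -/
theorem ae_perturb {f : SB → ℝ} (hf : SmoothSB f) {σ : (Fin 3 → ℝ) → ℝ}
    (hσ : ContDiff ℝ ∞ σ) : ∀ᵐ a : Fin 3 → ℝ, ∀ V : Set SB, IsOpen V →
      (∃ b ∈ V, σ (coords b) ≠ 0) → ∃ b ∈ V, hamSB (perturb f σ a) b ≠ 0 := by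
  have : SecondCountableTopology SB := coordsHomeo.secondCountableTopology
  obtain ⟨B, hBc, -, hB⟩ := TopologicalSpace.exists_countable_basis SB
  have hs : ∀ U ∈ B, ∀ᵐ a : Fin 3 → ℝ, (∃ b ∈ U, σ (coords b) ≠ 0) →
      ∃ b ∈ U, hamSB (perturb f σ a) b ≠ 0 := by
    intro U hU
    by_cases h : ∃ b ∈ U, σ (coords b) ≠ 0
    · have ho : IsOpen (U ∩ {b | σ (coords b) ≠ 0}) :=
        (hB.isOpen hU).inter (isOpen_ne.preimage (hσ.continuous.comp continuous_coords))
      have ho' : IsOpen (coords '' (U ∩ {b | σ (coords b) ≠ 0})) := coordsHomeo.isOpenMap _ ho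
      have hn : (coords '' (U ∩ {b | σ (coords b) ≠ 0})).Nonempty := by
        obtain ⟨b, h1, h2⟩ := h
        exact ⟨_, b, ⟨h1, h2⟩, rfl⟩
      -- The identity must be avoided because dc vanishes there. One good point in each basic open
      -- set is enough for density.
      obtain ⟨v, ⟨b, ⟨h1, h2⟩, rfl⟩, hv⟩ :=
        (dense_compl_singleton (0 : Fin 3 → ℝ)).inter_open_nonempty _ ho' hn
      obtain ⟨L, hL, hLa⟩ := hamSB_perturb hf hσ hv h2
      have h0 := volume_affine_eq_zero hL (hamSB f b)
      filter_upwards [measure_eq_zero_iff_ae_notMem.1 h0] with a ha _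
      exact ⟨b, h1, by rw [hLa]; exact ha⟩
    · exact Filter.Eventually.of_forall fun a h' => absurd h' h
  filter_upwards [(ae_ball_iff hBc).2 hs] with a ha V hV ⟨b, hb, hσb⟩
  obtain ⟨U, hU, hbU, hUV⟩ := hB.exists_subset_of_mem_open hb hV
  obtain ⟨b', h1, h2⟩ := ha U hU ⟨b, hbU, hσb⟩
  exact ⟨b', hUV h1, h2⟩

theorem ae_genIndepSB {f : SB → ℝ} (hf : SmoothSB f) : ∀ᵐ a : Fin 3 → ℝ, GenIndepSB
    ![casimir, fun b => f b + ∑ i : Fin 3, a i * coords b i] := by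
  have hσ : ContDiff ℝ ∞ fun _ : Fin 3 → ℝ => (1 : ℝ) := contDiff_const
  filter_upwards [ae_perturb hf hσ] with a ha
  have e : (fun b => f b + ∑ i : Fin 3, a i * coords b i) = perturb f (fun _ => 1) a :=
    funext fun b => by rw [perturb, one_mul]
  rw [e, genIndepSB_casimir_iff (hasFDerivAt_perturb hf hσ a).1, dense_iff_inter_open]
  rintro V hV ⟨b, hb⟩
  exact ha V hV ⟨b, hb, one_ne_zero⟩

/-! ### Complete integrability -/

/-- Every smooth function Poisson-commutes with one that is generically independent of the
Casimir function. -/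
theorem exists_commuting_genIndepSB {f : SB → ℝ} (hf : SmoothSB f) : ∃ h : SB → ℝ, SmoothSB h ∧
    (∀ b, bracketSB h f b = 0) ∧ GenIndepSB ![casimir, h] := by
  -- W is the open set on which f fails to be independent of c; the cutoff is nonzero exactly on W.
  set W : Set SB := interior {b | hamSB f b = 0} with hW
  have hWo : IsOpen (coords '' W) := coordsHomeo.isOpenMap _ isOpen_interior
  obtain ⟨σ, hsupp, hσ, hrange⟩ := hWo.exists_contDiff_support_eq (n := ⊤)
  have hσ' : ContDiff ℝ ∞ σ := hσ
  have hinj : Function.Injective coords := coordsHomeo.injective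
  have hmem : ∀ b, σ (coords b) ≠ 0 ↔ b ∈ W := fun b => by
    rw [← Function.mem_support, hsupp, hinj.mem_set_image]
  have hnn : ∀ v, 0 ≤ σ v := fun v => (hrange ⟨v, rfl⟩).1
  have hout : ∀ b ∉ W, ∀ a i, partialSB i (perturb f σ a) b = partialSB i f b := by
    intro b hb a i
    have h0 : σ (coords b) = 0 := not_not.1 fun h => hb ((hmem b).1 h)
    -- A nonnegative function has zero differential at its zeros, so off W, including the boundary,
    -- the perturbation does not change df.
    have hmin : IsLocalMin σ (coords b) := Filter.Eventually.of_forall fun v => h0 ▸ hnn v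
    rw [(hasFDerivAt_perturb hf hσ' a).2, h0, hmin.fderiv_eq_zero]
    simp
  obtain ⟨a, ha⟩ := (ae_perturb hf hσ').exists
  have hsm := (hasFDerivAt_perturb hf hσ' a).1
  refine ⟨perturb f σ a, hsm, fun b => ?_, ?_⟩
  -- On W the Hamiltonian vector of f is zero; off W the bracket is that of f with itself.
  · by_cases hb : b ∈ W
    · have hb' : b ∈ {b | hamSB f b = 0} := interior_subset hb
      have h0 : hamSB f b = 0 := hb'
      rw [bracketSB_eq_ham, h0]
      simp
    · rw [bracketSB, hout b hb, hout b hb, hout b hb]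
      ring
  · rw [genIndepSB_casimir_iff hsm, dense_iff_inter_open]
    rintro V hV ⟨b, hb⟩
    by_cases hVW : ∃ b ∈ V, b ∈ W
    · obtain ⟨b', h1, h2⟩ := hVW
      exact ha V hV ⟨b', h1, (hmem b').2 h2⟩
    · push Not at hVW
      have h1 : ¬ V ⊆ {b | hamSB f b = 0} := fun h =>
        hVW b hb (interior_maximal h hV hb)
      obtain ⟨b', hb', hne⟩ := Set.not_subset.1 h1
      refine ⟨b', hb', fun h0 => hne ?_⟩
      have h2 := hout b' (hVW b' hb') a
      rw [hamSB_eq_zero_iff, h2, h2, h2] at h0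
      exact (hamSB_eq_zero_iff f b').2 h0

/-- The integrals are c ∘ π₁, k ∘ π₁ and l ∘ π₂, with k commuting with f and l any function
generically independent of c. H itself need not be among them, since f may depend on c, for instance
when it is constant. -/
theorem completelyIntegrable_leftProj {f : SB → ℝ} (hf : SmoothSB f) :
    CompletelyIntegrable fun g => f (leftProj g) := by
  obtain ⟨k, hk, hkf, hkc⟩ := exists_commuting_genIndepSB hf
  obtain ⟨l, hl, hlc⟩ : ∃ l : SB → ℝ, SmoothSB l ∧ GenIndepSB ![casimir, l] := by
    have h0 : SmoothSB fun _ => (0 : ℝ) := contDiff_const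
    -- Perturbing the zero function shows that l can be a linear function of the coordinates.
    obtain ⟨a, ha⟩ := (ae_genIndepSB h0).exists
    refine ⟨fun b => (0 : ℝ) + ∑ i : Fin 3, a i * coords b i, ?_, ha⟩
    exact ContDiff.add contDiff_const (ContDiff.sum fun i _ =>
      ContDiff.mul contDiff_const (smoothSB_coords i))
  refine ⟨smoothD_leftProj hf, ![fun p => casimir (leftProj p), fun p => k (leftProj p),
    fun p => l (rightProj p)], fun i => ?_, fun i g => ?_,
    involution hk hl, (genIndepD_iff hk hl).2 ⟨hkc, hlc⟩⟩
  · fin_cases i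
    exacts [smoothD_leftProj smoothSB_casimir, smoothD_leftProj hk, smoothD_rightProj hl]
  · fin_cases i
    · exact (bracketD_leftProj smoothSB_casimir hf g).trans (bracketSB_casimir f _)
    · exact (bracketD_leftProj hk hf g).trans (hkf _)
    · exact bracketD_eq_zero_symm (bracketD_leftProj_rightProj hf hl g)

end DoubleSL

end

theorem mainTheorem6 :
    -- the bracket on `SL(2,ℂ)` is the Poisson bracket of a symplectic structure
    DoubleSL.IsSymplecticBracket DoubleSL.bracketD ∧
    -- `c` is a Casimir function on `SB(2,ℂ)`
    (DoubleSL.SmoothSB DoubleSL.casimir ∧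
      ∀ f : DoubleSL.SB → ℝ, DoubleSL.SmoothSB f →
        ∀ b, DoubleSL.bracketSB DoubleSL.casimir f b = 0) ∧
    -- pullbacks of smooth functions are smooth
    (∀ f : DoubleSL.SB → ℝ, DoubleSL.SmoothSB f →
      DoubleSL.SmoothD (fun g => f (DoubleSL.leftProj g)) ∧
      DoubleSL.SmoothD (fun g => f (DoubleSL.rightProj g))) ∧
    -- the projections are Poisson maps, onto `SB(2,ℂ)` with its bracket and with the opposite one
    (∀ f h : DoubleSL.SB → ℝ, DoubleSL.SmoothSB f → DoubleSL.SmoothSB h → ∀ g : DoubleSL.D,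
      DoubleSL.bracketD (fun p => f (DoubleSL.leftProj p)) (fun p => h (DoubleSL.leftProj p)) g
          = DoubleSL.bracketSB f h (DoubleSL.leftProj g) ∧
      DoubleSL.bracketD (fun p => f (DoubleSL.rightProj p)) (fun p => h (DoubleSL.rightProj p)) g
          = -DoubleSL.bracketSB f h (DoubleSL.rightProj g)) ∧
    -- pullbacks under the two projections Poisson-commute
    (∀ f h : DoubleSL.SB → ℝ, DoubleSL.SmoothSB f → DoubleSL.SmoothSB h → ∀ g : DoubleSL.D,
      DoubleSL.bracketD (fun p => f (DoubleSL.leftProj p)) (fun p => h (DoubleSL.rightProj p)) g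
          = 0) ∧
    -- `c ∘ π₁`, `f ∘ π₁`, `h ∘ π₂` are in involution
    (∀ f h : DoubleSL.SB → ℝ, DoubleSL.SmoothSB f → DoubleSL.SmoothSB h →
      ∀ (i j : Fin 3) (g : DoubleSL.D),
        DoubleSL.bracketD
          ((![fun p => DoubleSL.casimir (DoubleSL.leftProj p), fun p => f (DoubleSL.leftProj p),
              fun p => h (DoubleSL.rightProj p)] : Fin 3 → DoubleSL.D → ℝ) i)
          ((![fun p => DoubleSL.casimir (DoubleSL.leftProj p), fun p => f (DoubleSL.leftProj p),
              fun p => h (DoubleSL.rightProj p)] : Fin 3 → DoubleSL.D → ℝ) j) g = 0) ∧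
    -- they are generically independent exactly when `c, f` and `c, h` are so on `SB(2,ℂ)`
    (∀ f h : DoubleSL.SB → ℝ, DoubleSL.SmoothSB f → DoubleSL.SmoothSB h →
      (DoubleSL.GenIndepD
          ![fun p => DoubleSL.casimir (DoubleSL.leftProj p), fun p => f (DoubleSL.leftProj p),
            fun p => h (DoubleSL.rightProj p)] ↔
        DoubleSL.GenIndepSB ![DoubleSL.casimir, f] ∧
          DoubleSL.GenIndepSB ![DoubleSL.casimir, h])) ∧
    -- and this holds for generic functions
    (∀ f : DoubleSL.SB → ℝ, DoubleSL.SmoothSB f →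
      ∀ᵐ a : Fin 3 → ℝ, DoubleSL.GenIndepSB
        ![DoubleSL.casimir, fun b => f b + ∑ i : Fin 3, a i * DoubleSL.coords b i]) ∧
    -- complete integrability
    (∀ f : DoubleSL.SB → ℝ, DoubleSL.SmoothSB f →
      DoubleSL.CompletelyIntegrable (fun g => f (DoubleSL.leftProj g))) := by
  open DoubleSL in
  exact ⟨isSymplecticBracket_bracketD, ⟨smoothSB_casimir, fun f _ b => bracketSB_casimir f b⟩,
    fun f hf => ⟨smoothD_leftProj hf, smoothD_rightProj hf⟩,
    fun f h hf hh g => ⟨bracketD_leftProj hf hh g, bracketD_rightProj hf hh g⟩,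
    fun f h hf hh g => bracketD_leftProj_rightProj hf hh g,
    fun f h hf hh i j g => involution hf hh i j g,
    fun f h hf hh => genIndepD_iff hf hh,
    fun f hf => ae_genIndepSB hf,
    fun f hf => completelyIntegrable_leftProj hf⟩
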